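/- Let $(X,g)$ be a smooth $n$-dimensional Riemannian manifold (without boundary) and let $\phi$ be a calibration of degree $p\ge 1$ on $X$, i.e. a smooth closed differential $p$-form with $\phi(\xi)\le 1$ for every unit simple tangent $p$-vector $\xi$. Let $G_x(\phi)$ be the set of $\phi$-planes at $x\in X$, i.e. of the unit simple $p$-vectors $\xi$ at $x$ (the products $v_1\wedge\dots\wedge v_p$ of orthonormal tangent vectors) with $\phi(\xi)=1$. For $f\in C^\infty(X)$ let $\operatorname{Hess} f$ be the Riemannian Hessian, regarded as an endomorphism of $TX$, and let $$\mathcal H^\phi(f)(v_1,\dots,v_p)=\sum_{k=1}^p\phi\bigl(v_1,\dots,(\operatorname{Hess} f)\,v_k,\dots,v_p\bigr)$$ be the $\phi$-Hessian of $f$. The function $f$ is called $\phi$-plurisubharmonic if $\mathcal H^\phi(f)(\xi)\ge 0$ for all $x\in X$ and all $\xi\in G_x(\phi)$. A $\phi$-submanifold is an oriented (embedded) $p$-dimensional submanifold $M\subset X$ whose oriented unit tangent $p$-vector at $x$ lies in $G_x(\phi)$ for every $x\in M$. The calibration $\phi$ is integrable if for each $x\in X$ and each $\xi\in G_x(\phi)$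 there is a $\phi$-submanifold through $x$ whose oriented unit tangent $p$-vector at $x$ is $\xi$. A smooth function on $M$ is subharmonic if its Laplacian $\Delta_M$ (the trace of the Hessian, for the metric induced on $M$) is nonnegative. **Theorem.** Let $f\in C^\infty(X)$. 1. If $f$ is $\phi$-plurisubharmonic, then for every $\phi$-submanifold $M\subset X$ the restriction $f|_M$ is subharmonic in the induced metric. 2. If $\phi$ is integrable, the converse holds: if $f|_M$ is subharmonic in the induced metric for every $\phi$-submanifold $M\subset X$, then $f$ is $\phi$-plurisubharmonic. -/

import Mathlib

set_option maxSynthPendingDepth 3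

open scoped Manifold ContDiff Topology Bundle

noncomputable section

namespace Calibrated

/-! ### Linear algebra: `p`-vectors, pairings and the derivation `λ_φ` -/

section LinearAlgebra

variable {V : Type*} [AddCommGroup V] [Module ℝ V] {p : ℕ}

/-- The value `α(ξ)` of an alternating `p`-form `α` on a `p`-vector `ξ ∈ Λᵖ V`; it is characterised by
`α(v₁ ∧ ⋯ ∧ v_p) = α(v₁, …, v_p)`. -/
def evalPVector (α : V [⋀^Fin p]→ₗ[ℝ] ℝ) (ξ : ⋀[ℝ]^p V) : ℝ :=
  exteriorPower.alternatingMapLinearEquiv α ξ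

theorem evalPVector_ιMulti (α : V [⋀^Fin p]→ₗ[ℝ] ℝ) (v : Fin p → V) :
    evalPVector α (exteriorPower.ιMulti ℝ p v) = α v :=
  exteriorPower.alternatingMapLinearEquiv_apply_ιMulti α v

/-- The family `v` is orthonormal for the bilinear form `B`. -/
def IsOrthonormalFor (B : V → V → ℝ) (v : Fin p → V) : Prop :=
  ∀ i j, B (v i) (v j) = if i = j then 1 else 0

/-- The unit simple `p`-vectors: the exterior products `v₁ ∧ ⋯ ∧ v_p` of orthonormal families. -/
def unitSimplePVectors (B : V → V → ℝ) (p : ℕ) : Set (⋀[ℝ]^p V) :=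
  {ξ | ∃ v : Fin p → V, IsOrthonormalFor B v ∧ ξ = exteriorPower.ιMulti ℝ p v}

/-- The form `λ_φ(A) = D_{Aᵗ} φ`: the endomorphism `A` of `V` acts on the `p`-form `φ` as a derivation
through its transpose, i.e.
`λ_φ(A)(v₁, …, v_p) = ∑ₖ φ(v₁, …, A vₖ, …, v_p)`. -/
def lambdaMap (φ : V [⋀^Fin p]→ₗ[ℝ] ℝ) (A : V →ₗ[ℝ] V) : V [⋀^Fin p]→ₗ[ℝ] ℝ where
  toFun v := ∑ k, φ (Function.update v k (A (v k)))
  map_update_add' := by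
    intro inst v i x y
    obtain rfl : inst = instDecidableEqFin p := Subsingleton.elim _ _
    rw [← Finset.sum_add_distrib]
    refine Finset.sum_congr rfl fun k _ ↦ ?_
    by_cases h : k = i
    · subst h; simp
    · simp only [Function.update_of_ne h, Function.update_comm (Ne.symm h),
        AlternatingMap.map_update_add]
  map_update_smul' := by
    intro inst v i c x
    obtain rfl : inst = instDecidableEqFin p := Subsingleton.elim _ _
    rw [Finset.smul_sum]
    refine Finset.sum_congr rfl fun k _ ↦ ?_
    by_cases h : k = i
    · subst h; simp
    · simp only [Function.update_of_ne h, Function.update_comm (Ne.symm h),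
        AlternatingMap.map_update_smul]
  map_eq_zero_of_eq' := by
    intro v i j hv hij
    have hswap : φ (Function.update v j (A (v j))) = - φ (Function.update v i (A (v i))) := by
      rw [← AlternatingMap.map_swap φ _ hij]
      congr 1
      ext l
      by_cases hl : l = i
      · subst hl; simp [hv, hij, hij.symm]
      · by_cases hl' : l = j
        · subst hl'; simp [hv]
        · simp [Equiv.swap_apply_of_ne_of_ne hl hl', hl, hl']
    rw [← Finset.add_sum_erase _ _ (Finset.mem_univ i),
      ← Finset.add_sum_erase _ _ (Finset.mem_erase.2 ⟨hij.symm, Finset.mem_univ j⟩), hswap,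
      Finset.sum_eq_zero, add_zero, add_neg_cancel]
    intro k hk
    simp only [Finset.mem_erase, Finset.mem_univ, and_true] at hk
    refine AlternatingMap.map_eq_zero_of_eq φ _ (i := i) (j := j) ?_ hij
    rw [Function.update_of_ne (Ne.symm hk.2), Function.update_of_ne (Ne.symm hk.1), hv]

end LinearAlgebra

/-! ### The Hessian of a function on an open piece of a normed space with a variable metric -/

section Coordinates

variable {E : Type*} [NormedAddCommGroup E] [NormedSpace ℝ E]

/-- The Christoffel symbols of the first kind of the metric `G`, at the point `y`:
`Γ(u, v; w) = ½ (∂_u G(v, w) + ∂_v G(u, w) - ∂_w G(u, v))`. -/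
def christoffelLower (G : E → E →L[ℝ] E →L[ℝ] ℝ) (y : E) : E →L[ℝ] E →L[ℝ] E →L[ℝ] ℝ :=
  let D : E →L[ℝ] E →L[ℝ] E →L[ℝ] ℝ := fderiv ℝ G y
  (1 / 2 : ℝ) • (D + D.flip -
    (ContinuousLinearMap.flipₗᵢ ℝ E E ℝ).toContinuousLinearEquiv.toContinuousLinearMap.comp D.flip)

theorem christoffelLower_apply (G : E → E →L[ℝ] E →L[ℝ] ℝ) (y u v w : E) :
    christoffelLower G y u v w =
      (1 / 2 : ℝ) * (fderiv ℝ G y u v w + fderiv ℝ G y v u w - fderiv ℝ G y w u v) := rfl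

/-- The Christoffel symbols of the Levi-Civita connection of the metric `G`, at the point `y`:
`Γ(u, v)` is the vector with `G(Γ(u, v), w) = Γ(u, v; w)` for all `w`. -/
def christoffel (G : E → E →L[ℝ] E →L[ℝ] ℝ) (y : E) : E →L[ℝ] E →L[ℝ] E :=
  (ContinuousLinearMap.compL ℝ E (E →L[ℝ] ℝ) E (G y).inverse).comp (christoffelLower G y)

theorem apply_christoffel (G : E → E →L[ℝ] E →L[ℝ] ℝ) (y : E) (h : (G y).IsInvertible)
    (u v w : E) : G y (christoffel G y u v) w = christoffelLower G y u v w := by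
  obtain ⟨e, he⟩ := h
  simp [christoffel, ← he]

/-- The Hessian of `F` for the metric `G`, at the point `y`:
`Hess F (u, v) = ∂_u ∂_v F - dF(Γ(u, v))`. -/
def coordHessian (G : E → E →L[ℝ] E →L[ℝ] ℝ) (F : E → ℝ) (y : E) : E →L[ℝ] E →L[ℝ] ℝ :=
  fderiv ℝ (fderiv ℝ F) y
    - (ContinuousLinearMap.compL ℝ E E ℝ (fderiv ℝ F y)).comp (christoffel G y)

theorem coordHessian_apply (G : E → E →L[ℝ] E →L[ℝ] ℝ) (F : E → ℝ) (y u v : E) :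
    coordHessian G F y u v =
      fderiv ℝ (fderiv ℝ F) y u v - fderiv ℝ F y (christoffel G y u v) := rfl

end Coordinates

/-! ### Covariant tensor fields and forms on manifolds without boundary -/

section Manifold

variable {E : Type*} [NormedAddCommGroup E] [NormedSpace ℝ E]
  {X : Type*} [TopologicalSpace X] [ChartedSpace E X]
  {E' : Type*} [NormedAddCommGroup E'] [NormedSpace ℝ E']
  {Y : Type*} [TopologicalSpace Y] [ChartedSpace E' Y]

variable (E X) in
/-- Fields of bilinear forms on the tangent spaces of `X`. -/
abbrev BilinField : Type _ :=
  (x : X) → TangentSpace 𝓘(ℝ, E) x →L[ℝ] TangentSpace 𝓘(ℝ, E) x →L[ℝ] ℝ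

variable (E X) in
/-- Fields of alternating `p`-forms on the tangent spaces of `X`. -/
abbrev FormField (p : ℕ) : Type _ :=
  (x : X) → TangentSpace 𝓘(ℝ, E) x [⋀^Fin p]→L[ℝ] ℝ

variable (E X) in
/-- Smooth Riemannian metrics on `X`. -/
abbrev Metric [IsManifold 𝓘(ℝ, E) ∞ X] : Type _ :=
  Bundle.ContMDiffRiemannianMetric 𝓘(ℝ, E) ∞ E (fun x : X ↦ TangentSpace 𝓘(ℝ, E) x)

/-- The pullback `(F^* g)_y(u, v) = g_{F y}(dF u, dF v)`. -/
def pullbackBilin (F : Y → X) (g : BilinField E X) (y : Y) :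
    TangentSpace 𝓘(ℝ, E') y →L[ℝ] TangentSpace 𝓘(ℝ, E') y →L[ℝ] ℝ :=
  (ContinuousLinearMap.precomp ℝ (mfderiv 𝓘(ℝ, E') 𝓘(ℝ, E) F y)).comp
    ((g (F y)).comp (mfderiv 𝓘(ℝ, E') 𝓘(ℝ, E) F y))

theorem pullbackBilin_apply (F : Y → X) (g : BilinField E X) (y : Y)
    (u v : TangentSpace 𝓘(ℝ, E') y) :
    pullbackBilin F g y u v =
      g (F y) (mfderiv 𝓘(ℝ, E') 𝓘(ℝ, E) F y u) (mfderiv 𝓘(ℝ, E') 𝓘(ℝ, E) F y v) := rfl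

/-- The pullback `(F^* φ)_y(v₁, …, v_p) = φ_{F y}(dF v₁, …, dF v_p)`. -/
def pullbackForm {p : ℕ} (F : Y → X) (φ : FormField E X p) (y : Y) :
    TangentSpace 𝓘(ℝ, E') y [⋀^Fin p]→L[ℝ] ℝ :=
  (φ (F y)).compContinuousLinearMap (mfderiv 𝓘(ℝ, E') 𝓘(ℝ, E) F y)

/-- The expression of a field of bilinear forms in the chart at `x₀`. -/
def coordBilin (g : BilinField E X) (x₀ : X) (y : E) : E →L[ℝ] E →L[ℝ] ℝ :=
  pullbackBilin (E' := E) (Y := E) (extChartAt 𝓘(ℝ, E) x₀).symm g y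

theorem coordBilin_apply (g : BilinField E X) (x₀ : X) (y u v : E) :
    coordBilin g x₀ y u v = g ((extChartAt 𝓘(ℝ, E) x₀).symm y)
      (mfderiv 𝓘(ℝ, E) 𝓘(ℝ, E) (extChartAt 𝓘(ℝ, E) x₀).symm y u)
      (mfderiv 𝓘(ℝ, E) 𝓘(ℝ, E) (extChartAt 𝓘(ℝ, E) x₀).symm y v) := rfl

/-- The expression of a field of `p`-forms in the chart at `x₀`. -/
def coordForm {p : ℕ} (φ : FormField E X p) (x₀ : X) (y : E) : E [⋀^Fin p]→L[ℝ] ℝ :=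
  pullbackForm (E' := E) (Y := E) (extChartAt 𝓘(ℝ, E) x₀).symm φ y

theorem coordForm_apply {p : ℕ} (φ : FormField E X p) (x₀ : X) (y : E) (v : Fin p → E) :
    coordForm φ x₀ y v = φ ((extChartAt 𝓘(ℝ, E) x₀).symm y)
      (fun i ↦ mfderiv 𝓘(ℝ, E) 𝓘(ℝ, E) (extChartAt 𝓘(ℝ, E) x₀).symm y (v i)) := rfl

/-- A `C^∞` differential form: it is `C^∞` in the charts. -/
def IsSmoothForm {p : ℕ} (φ : FormField E X p) : Prop :=
  ∀ x₀ : X, ContDiffOn ℝ ∞ (coordForm φ x₀) (extChartAt 𝓘(ℝ, E) x₀).target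

/-- A closed differential form: its exterior derivative, computed in the charts, vanishes. -/
def IsClosedForm {p : ℕ} (φ : FormField E X p) : Prop :=
  ∀ x₀ : X, ∀ y ∈ (extChartAt 𝓘(ℝ, E) x₀).target, extDeriv (coordForm φ x₀) y = 0

/-- The Riemannian Hessian `Hess f` of a function for the metric `g`, as a field of bilinear forms.
At `x` it is computed in the chart at `x`. -/
def hessian (g : BilinField E X) (f : X → ℝ) (x : X) :
    TangentSpace 𝓘(ℝ, E) x →L[ℝ] TangentSpace 𝓘(ℝ, E) x →L[ℝ] ℝ :=
  pullbackBilin (X := E) (extChartAt 𝓘(ℝ, E) x)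
    (coordHessian (coordBilin g x) (f ∘ (extChartAt 𝓘(ℝ, E) x).symm)) x

theorem hessian_apply (g : BilinField E X) (f : X → ℝ) (x : X) (u v : TangentSpace 𝓘(ℝ, E) x) :
    hessian g f x u v =
      coordHessian (coordBilin g x) (f ∘ (extChartAt 𝓘(ℝ, E) x).symm) (extChartAt 𝓘(ℝ, E) x x)
        (mfderiv 𝓘(ℝ, E) 𝓘(ℝ, E) (extChartAt 𝓘(ℝ, E) x) x u)
        (mfderiv 𝓘(ℝ, E) 𝓘(ℝ, E) (extChartAt 𝓘(ℝ, E) x) x v) := rfl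

/-- The Hessian as an endomorphism of `T_x X`: `g(Hess f (u), v) = Hess f (u, v)`. -/
def hessianEnd (g : BilinField E X) (f : X → ℝ) (x : X) :
    TangentSpace 𝓘(ℝ, E) x →L[ℝ] TangentSpace 𝓘(ℝ, E) x :=
  (g x).inverse.comp (hessian g f x)

/-- The Laplace-Beltrami operator of the metric `g`: the trace of the Hessian. -/
def laplacian (g : BilinField E X) (f : X → ℝ) (x : X) : ℝ :=
  LinearMap.trace ℝ (TangentSpace 𝓘(ℝ, E) x) (hessianEnd g f x).toLinearMap

/-- A smooth function is subharmonic if its Laplacian is nonnegative. -/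
def IsSubharmonic (g : BilinField E X) (f : X → ℝ) : Prop :=
  ∀ x, 0 ≤ laplacian g f x

/-! ### Calibrations and plurisubharmonic functions -/

variable [IsManifold 𝓘(ℝ, E) ∞ X]

/-- The set of unit simple tangent `p`-vectors at `x`. -/
def unitSimpleAt (g : Metric E X) (p : ℕ) (x : X) : Set (⋀[ℝ]^p (TangentSpace 𝓘(ℝ, E) x)) :=
  unitSimplePVectors (fun u v ↦ g.inner x u v) p

/-- A calibration of degree `p`: a smooth closed `p`-form with `φ(ξ) ≤ 1` for all unit simple tangent
`p`-vectors `ξ`. -/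
structure IsCalibration {p : ℕ} (g : Metric E X) (φ : FormField E X p) : Prop where
  smooth : IsSmoothForm φ
  closed : IsClosedForm φ
  comass_le : ∀ x, ∀ ξ ∈ unitSimpleAt g p x, evalPVector (φ x).toAlternatingMap ξ ≤ 1

/-- The `φ`-Grassmannian `G_x(φ)`, i.e. the set of `φ`-planes at `x`: the unit simple tangent
`p`-vectors `ξ` with `φ(ξ) = 1`. -/
def phiGrassmannian {p : ℕ} (g : Metric E X) (φ : FormField E X p) (x : X) :
    Set (⋀[ℝ]^p (TangentSpace 𝓘(ℝ, E) x)) :=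
  {ξ | ξ ∈ unitSimpleAt g p x ∧ evalPVector (φ x).toAlternatingMap ξ = 1}

/-- The `φ`-Hessian `H^φ(f) = λ_φ(Hess f)`, a field of `p`-forms. -/
def phiHessian {p : ℕ} (g : Metric E X) (φ : FormField E X p) (f : X → ℝ) (x : X) :
    TangentSpace 𝓘(ℝ, E) x [⋀^Fin p]→ₗ[ℝ] ℝ :=
  lambdaMap (φ x).toAlternatingMap (hessianEnd g.inner f x).toLinearMap

/-- `f` is `φ`-plurisubharmonic: `H^φ(f)(ξ) ≥ 0` for all `φ`-planes `ξ`. -/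
def IsPlurisubharmonic {p : ℕ} (g : Metric E X) (φ : FormField E X p) (f : X → ℝ) : Prop :=
  ∀ x, ∀ ξ ∈ phiGrassmannian g φ x, 0 ≤ evalPVector (phiHessian g φ f x) ξ

end Manifold

/-! ### Submanifolds -/

universe u

variable {E : Type*} [NormedAddCommGroup E] [NormedSpace ℝ E]
  {X : Type u} [TopologicalSpace X] [ChartedSpace E X]

variable (E X) in
/-- An oriented (embedded, boundaryless) `p`-dimensional submanifold of `X`: a smooth `p`-manifold
with a smooth embedding into `X` and a continuous choice of orientations of its tangent spaces. -/
structure OrientedSubmanifold (p : ℕ) where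
  carrier : Type u
  [topology : TopologicalSpace carrier]
  [charted : ChartedSpace (EuclideanSpace ℝ (Fin p)) carrier]
  [manifold : IsManifold (𝓡 p) ∞ carrier]
  incl : carrier → X
  isSmoothEmbedding : Manifold.IsSmoothEmbedding (𝓡 p) 𝓘(ℝ, E) ∞ incl
  orientation : (m : carrier) → Orientation ℝ (TangentSpace (𝓡 p) m) (Fin p)
  /-- Read in the local trivialization of the tangent bundle at `m₀`, the orientation is constant
  near `m₀`. -/
  orientation_continuous : ∀ m₀ : carrier, ∃ o : Orientation ℝ (EuclideanSpace ℝ (Fin p)) (Fin p),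
    ∀ᶠ m in 𝓝 m₀, ∀ hm : m ∈
      (trivializationAt (EuclideanSpace ℝ (Fin p)) (TangentSpace (𝓡 p)) m₀).baseSet,
      Orientation.map (Fin p)
        ((trivializationAt (EuclideanSpace ℝ (Fin p)) (TangentSpace (𝓡 p)) m₀).continuousLinearEquivAt
          ℝ m hm).toLinearEquiv (orientation m) = o

attribute [instance] OrientedSubmanifold.topology OrientedSubmanifold.charted
  OrientedSubmanifold.manifold

namespace OrientedSubmanifold

variable {p : ℕ}

/-- The metric induced on a submanifold. -/
def inducedMetric [IsManifold 𝓘(ℝ, E) ∞ X] (M : OrientedSubmanifold E X p) (g : Metric E X) :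
    BilinField (EuclideanSpace ℝ (Fin p)) M.carrier :=
  pullbackBilin M.incl g.inner

/-- `ξ` is the oriented unit tangent space of `M` at `m`: the image in `Λᵖ T_{m} X` of
`e₁ ∧ ⋯ ∧ e_p`, where `e` is a positively oriented orthonormal basis of `T_m M`. -/
def IsOrientedTangent [IsManifold 𝓘(ℝ, E) ∞ X] (M : OrientedSubmanifold E X p) (g : Metric E X) (m : M.carrier)
    (ξ : ⋀[ℝ]^p (TangentSpace 𝓘(ℝ, E) (M.incl m))) : Prop :=
  ∃ e : Module.Basis (Fin p) ℝ (TangentSpace (𝓡 p) m),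
    e.orientation = M.orientation m ∧
    IsOrthonormalFor (fun u v ↦ M.inducedMetric g m u v) e ∧
    ξ = exteriorPower.ιMulti ℝ p (fun i ↦ mfderiv (𝓡 p) 𝓘(ℝ, E) M.incl m (e i))

/-- `M` is a `φ`-submanifold (is calibrated by `φ`): its oriented unit tangent spaces are
`φ`-planes. -/
def IsPhiSubmanifold [IsManifold 𝓘(ℝ, E) ∞ X] (M : OrientedSubmanifold E X p) (g : Metric E X) (φ : FormField E X p) : Prop :=
  ∀ m, ∃ ξ ∈ phiGrassmannian g φ (M.incl m), M.IsOrientedTangent g m ξ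

end OrientedSubmanifold

/-- The calibration `φ` is integrable: every `φ`-plane `ξ ∈ G_x(φ)` is the oriented unit tangent space
at `x` of some `φ`-submanifold through `x`. -/
def IsIntegrable [IsManifold 𝓘(ℝ, E) ∞ X] {p : ℕ} (g : Metric E X) (φ : FormField E X p) : Prop :=
  ∀ x, ∀ ξ ∈ phiGrassmannian g φ x,
    ∃ M : OrientedSubmanifold E X p, M.IsPhiSubmanifold g φ ∧
      ∃ (m : M.carrier) (η : ⋀[ℝ]^p (TangentSpace 𝓘(ℝ, E) (M.incl m))),
        M.IsOrientedTangent g m η ∧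
        (⟨M.incl m, η⟩ : (y : X) × ⋀[ℝ]^p (TangentSpace 𝓘(ℝ, E) y)) = ⟨x, ξ⟩

end Calibrated

end

/-!
The whole proof rests on one identity. Let `M` be a `φ`-submanifold, `e` an orthonormal basis of `T_m M`
and `v k` the image of `e k` in the ambient tangent space, with `φ(v) = 1`. Then
`Δ_M (f|_M) = ∑ k, Hess f (v k, v k) = H^φ(f)(v₁ ∧ ⋯ ∧ v_p)` (`laplacian_comp_incl_eq`). Every tangent
plane of a `φ`-submanifold is a `φ`-plane, which gives the first part; if `φ` is integrable, every
`φ`-plane is such a tangent plane, which gives the second.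

The second equality (`evalPVector_phiHessian`) is the first cousin principle (`apply_update_eq`): `φ` has
comass one and attains it at `v`, so that replacing `v k` by `u` multiplies `φ(v)` by `⟨v k, u⟩`. It follows
from Hadamard's inequality `φ(w) ≤ ∏ i, ‖w i‖`.

The first equality (`sum_coordHessian_comp`) says that calibrated submanifolds are minimal, i.e. that the
trace of the second fundamental form vanishes. It is proved pointwise, without the first variation of
area, in charts where the inclusion is a map `Φ`, the metric is `G` and the form is `θ`. Let `w` be a
vector normal to `M` at the point considered. Hadamard's inequality, differentiated in the base point at
its equality case, gives `D_w θ(v) = ½ ∑ k, D_w G(v k, v k)` (`fderiv_apply_eq_half_sum`). Closedness gives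
`D_w θ(v) = ∑ k, D_{v k} θ(v₁, …, w, …, v_p)` with `w` in the `k`-th slot
(`fderiv_apply_eq_sum_of_extDeriv_eq_zero`). Finally the first cousin principle, applied along `M` to the
normal part of `w` and differentiated, computes the terms of the last sum up to terms in the second
derivative of `Φ`, antisymmetric in two indices, that cancel (`fderiv_update_normal`). Together these three
facts say that the mean curvature vector has no component along `w` (`sum_normal_eq_zero`); the
tangential component vanishes by the Gauss formula (`apply_secondFundamentalForm_tangent`).
-/

open scoped Manifold ContDiff Topology Bundle

namespace Calibrated

/-! ### Linear algebra of forms of comass at most one -/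

section LinearAlgebra

variable {V : Type*} [AddCommGroup V] [Module ℝ V] {p : ℕ}

/-- The inner product given by a symmetric positive definite bilinear form. -/
@[reducible] noncomputable def coreOfBilin (B : V →ₗ[ℝ] V →ₗ[ℝ] ℝ) (hsymm : ∀ u v, B u v = B v u)
    (hpos : ∀ v, v ≠ 0 → 0 < B v v) : InnerProductSpace.Core ℝ V where
  inner u v := B u v
  conj_inner_symm u v := hsymm v u
  re_inner_nonneg v := by
    rcases eq_or_ne v 0 with rfl | hv
    · simp
    · simpa using (hpos v hv).le
  add_left u v w := by simp
  smul_left u v c := by simp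
  definite v h := by
    contrapose! h
    exact (hpos v h).ne'

/-- Hadamard's inequality for an alternating form of comass at most `1`. -/
theorem apply_le_prod_norm {W : Type*} [NormedAddCommGroup W] [InnerProductSpace ℝ W]
    (α : W [⋀^Fin p]→ₗ[ℝ] ℝ) (hα : ∀ v : Fin p → W, Orthonormal ℝ v → α v ≤ 1) (v : Fin p → W) :
    α v ≤ ∏ i, ‖v i‖ := by
  by_cases hv : LinearIndependent ℝ v
  swap
  · rw [α.map_linearDependent v hv]
    positivity
  rcases p with - | q
  · simpa using hα v ⟨fun i ↦ i.elim0, fun i ↦ i.elim0⟩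
  let S := Submodule.span ℝ (Set.range v)
  have : FiniteDimensional ℝ S := FiniteDimensional.span_of_finite ℝ (Set.finite_range v)
  let v' : Fin (q + 1) → S := fun i ↦ ⟨v i, Submodule.subset_span ⟨i, rfl⟩⟩
  have hdim : Module.finrank ℝ S = Fintype.card (Fin (q + 1)) := finrank_span_eq_card hv
  obtain ⟨b, hdet⟩ : ∃ b : OrthonormalBasis (Fin (q + 1)) ℝ S,
      b.toBasis.det v' = ∏ i, inner ℝ (b i) (v' i) :=
    ⟨InnerProductSpace.gramSchmidtOrthonormalBasis hdim v',
      InnerProductSpace.gramSchmidtOrthonormalBasis_det hdim v'⟩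
  have hdet_le : |b.toBasis.det v'| ≤ ∏ i, ‖v i‖ := by
    rw [hdet, Finset.abs_prod]
    refine Finset.prod_le_prod (fun i _ ↦ abs_nonneg _) fun i _ ↦ ?_
    refine (abs_real_inner_le_norm _ _).trans_eq ?_
    rw [b.orthonormal.1 i, one_mul]
    rfl
  have hon : Orthonormal ℝ fun i ↦ (b i : W) :=
    b.orthonormal.comp_linearIsometry S.subtypeₗᵢ
  -- Replacing `b 0` by `-b 0` turns the bound on `α` into a bound on `-α`.
  have hneg : Orthonormal ℝ (Function.update (fun i ↦ (b i : W)) 0 (-(b 0 : W))) := by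
    rw [orthonormal_iff_ite] at hon ⊢
    intro i j
    have hij := hon i j
    rcases eq_or_ne i 0 with rfl | hi <;> rcases eq_or_ne j 0 with rfl | hj
    · simpa using hij
    · simpa [hj, hj.symm] using hij
    · simpa [hi, hi.symm] using hij
    · simpa [hi, hj] using hij
  have hb : |α fun i ↦ (b i : W)| ≤ 1 := by
    refine abs_le.2 ⟨?_, hα _ hon⟩
    have h := hα _ hneg
    rw [AlternatingMap.map_update_neg, Function.update_eq_self] at h
    linarith
  have h1 : α v = (α fun i ↦ (b i : W)) * b.toBasis.det v' := by
    have := congrArg (fun β ↦ β v') ((α.compLinearMap S.subtype).eq_smul_basis_det b.toBasis)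
    simpa [v', Function.comp_def] using this
  rw [h1]
  refine (le_abs_self _).trans ?_
  rw [abs_mul]
  exact (mul_le_of_le_one_left (abs_nonneg _) hb).trans hdet_le

/-- Hadamard's inequality for a form of comass at most `1` with respect to a bilinear form `B`. -/
theorem apply_le_prod_sqrt (B : V →ₗ[ℝ] V →ₗ[ℝ] ℝ) (hsymm : ∀ u v, B u v = B v u)
    (hpos : ∀ v, v ≠ 0 → 0 < B v v) (α : V [⋀^Fin p]→ₗ[ℝ] ℝ)
    (hα : ∀ v : Fin p → V, IsOrthonormalFor (fun u v ↦ B u v) v → α v ≤ 1) (v : Fin p → V) :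
    α v ≤ ∏ i, √(B (v i) (v i)) := by
  let c := coreOfBilin B hsymm hpos
  let _ : NormedAddCommGroup V := c.toNormedAddCommGroup
  let _ : InnerProductSpace ℝ V := InnerProductSpace.ofCore c.toCore
  exact apply_le_prod_norm α (fun w hw ↦ hα w (orthonormal_iff_ite.1 hw)) v

/-- First cousin principle: a form of comass at most `1` attains its maximum at an orthonormal family
`v` with `α v = 1`, so that its first order variation there is the one of the volume. -/
theorem apply_update_eq (B : V →ₗ[ℝ] V →ₗ[ℝ] ℝ) (hsymm : ∀ u v, B u v = B v u)
    (hpos : ∀ v, v ≠ 0 → 0 < B v v) (α : V [⋀^Fin p]→ₗ[ℝ] ℝ)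
    (hα : ∀ v : Fin p → V, IsOrthonormalFor (fun u v ↦ B u v) v → α v ≤ 1) {v : Fin p → V}
    (hv : IsOrthonormalFor (fun u v ↦ B u v) v) (h1 : α v = 1) (k : Fin p) (u : V) :
    α (Function.update v k u) = B (v k) u := by
  -- Hadamard's inequality for the variation `v k + t • u` is the inequality `0 ≤ F t`.
  let F : ℝ → ℝ := fun t ↦ √(1 + t * (2 * B (v k) u) + t ^ 2 * B u u)
    - (1 + t * α (Function.update v k u))
  have hF : ∀ t, 0 ≤ F t := by
    intro t
    have h := apply_le_prod_sqrt B hsymm hpos α hα (Function.update v k (v k + t • u))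
    rw [AlternatingMap.map_update_add, AlternatingMap.map_update_smul, Function.update_eq_self, h1,
      Finset.prod_eq_single k] at h
    · have hkk := hv k k
      simp only [if_true] at hkk
      have e : B (v k + t • u) (v k + t • u) =
          1 + t * (2 * B (v k) u) + t ^ 2 * B u u := by
        simp only [map_add, LinearMap.add_apply, map_smul, LinearMap.smul_apply, smul_eq_mul, hkk,
          hsymm u (v k)]
        ring
      rw [Function.update_self, e, smul_eq_mul] at h
      exact sub_nonneg.2 h
    · intro j _ hj
      have hjj := hv j j
      simp only [if_true] at hjj
      rw [Function.update_of_ne hj, hjj, Real.sqrt_one]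
    · simp
  have hder : HasDerivAt F (B (v k) u - α (Function.update v k u)) 0 := by
    have ha : HasDerivAt (fun t : ℝ ↦ 1 + t * (2 * B (v k) u) + t ^ 2 * B u u)
        (2 * B (v k) u) 0 := by
      have := (((hasDerivAt_id (0 : ℝ)).mul_const (2 * B (v k) u)).const_add 1).fun_add
        ((hasDerivAt_pow 2 (0 : ℝ)).mul_const (B u u))
      simpa using this
    have hb : HasDerivAt (fun t : ℝ ↦ 1 + t * α (Function.update v k u))
        (α (Function.update v k u)) 0 := by
      simpa using ((hasDerivAt_id (0 : ℝ)).mul_const (α (Function.update v k u))).const_add 1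
    simpa [F] using (ha.sqrt (by simp)).fun_sub hb
  have hmin : IsLocalMin F 0 := Filter.Eventually.of_forall fun t ↦ by
    simpa [F] using hF t
  linarith [hmin.hasDerivAt_eq_zero hder]

/-- If `w` has vanishing contraction with the form `α` on one frame of the image of `T`, then it has
vanishing contraction with `α` on every family of vectors of this image. -/
theorem apply_update_eq_zero_of_basis {W : Type*} [AddCommGroup W] [Module ℝ W]
    (α : V [⋀^Fin p]→ₗ[ℝ] ℝ) (T : W →ₗ[ℝ] V) (b : Module.Basis (Fin p) ℝ W) (w : V)
    (h : ∀ k, α (Function.update (fun i ↦ T (b i)) k w) = 0) (a : Fin p → W) (k : Fin p) :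
    α (Function.update (fun i ↦ T (a i)) k w) = 0 := by
  rcases p with - | q
  · exact k.elim0
  have key : (α.curryLeft w).compLinearMap T = 0 := by
    refine Module.Basis.ext_alternating b fun σ hσ ↦ ?_
    obtain ⟨l, hl⟩ : ∃ l, ∀ i, σ i ≠ l := by
      by_contra! hs
      have := Fintype.card_le_of_surjective σ hs
      simp at this
    have hinj : Function.Injective (Fin.cons l σ : Fin (q + 1) → Fin (q + 1)) := by
      rw [Fin.cons_injective_iff]
      exact ⟨fun ⟨i, hi⟩ ↦ hl i hi, hσ⟩
    let τ : Equiv.Perm (Fin (q + 1)) := Equiv.ofBijective _ (Finite.injective_iff_bijective.1 hinj)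
    have e : (Matrix.vecCons w fun i ↦ T (b (σ i))) =
        Function.update (fun i ↦ T (b i)) l w ∘ τ := by
      ext i
      refine Fin.cases ?_ (fun j ↦ ?_) i
      · simp [τ]
      · simp [τ, hl j]
    simp only [AlternatingMap.compLinearMap_apply, AlternatingMap.curryLeft_apply_apply,
      AlternatingMap.zero_apply]
    rw [e, AlternatingMap.map_perm, h, smul_zero]
  have e : Function.update (fun i ↦ T (a i)) k w = k.insertNth w fun i ↦ T (a (k.succAbove i)) := by
    rw [← Fin.insertNth_removeNth]
    rfl
  rw [e, AlternatingMap.map_insertNth]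
  have := congrArg (fun β ↦ β fun i ↦ a (k.succAbove i)) key
  simp only [AlternatingMap.compLinearMap_apply, AlternatingMap.curryLeft_apply_apply,
      AlternatingMap.zero_apply] at this
  rw [this, smul_zero]

end LinearAlgebra

/-! ### Calibrated forms and induced metrics in coordinates -/

section Coordinates

variable {E : Type*} [NormedAddCommGroup E] [NormedSpace ℝ E]
  {E' : Type*} [NormedAddCommGroup E'] [NormedSpace ℝ E'] {p : ℕ}

/-- `B` is an inner product, and the form `α` has comass at most `1` for it. -/
structure IsCalibratingPair (B : E →L[ℝ] E →L[ℝ] ℝ) (α : E [⋀^Fin p]→L[ℝ] ℝ) : Prop where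
  symm : ∀ u v, B u v = B v u
  pos : ∀ v, v ≠ 0 → 0 < B v v
  comass_le : ∀ v : Fin p → E, IsOrthonormalFor (fun u v ↦ B u v) v → α v ≤ 1

theorem IsCalibratingPair.apply_le {B : E →L[ℝ] E →L[ℝ] ℝ} {α : E [⋀^Fin p]→L[ℝ] ℝ}
    (h : IsCalibratingPair B α) (v : Fin p → E) : α v ≤ ∏ i, √(B (v i) (v i)) :=
  apply_le_prod_sqrt B.toLinearMap₁₂ h.symm h.pos α.toAlternatingMap h.comass_le v

theorem IsCalibratingPair.apply_update {B : E →L[ℝ] E →L[ℝ] ℝ} {α : E [⋀^Fin p]→L[ℝ] ℝ}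
    (h : IsCalibratingPair B α) {v : Fin p → E} (hv : IsOrthonormalFor (fun u v ↦ B u v) v)
    (h1 : α v = 1) (k : Fin p) (u : E) : α (Function.update v k u) = B (v k) u :=
  apply_update_eq B.toLinearMap₁₂ h.symm h.pos α.toAlternatingMap h.comass_le hv h1 k u

/-- Closedness of a form, as a formula for its derivative in one direction. -/
theorem fderiv_apply_eq_sum_of_extDeriv_eq_zero {θ : E → E [⋀^Fin p]→L[ℝ] ℝ} {y : E}
    (hθ : extDeriv θ y = 0) (w : E) (v : Fin p → E) :
    fderiv ℝ θ y w v = ∑ k, fderiv ℝ θ y (v k) (Function.update v k w) := by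
  have h := congrArg (fun β ↦ β (Fin.cons w v : Fin (p + 1) → E)) hθ
  simp only [extDeriv, ContinuousAlternatingMap.alternatizeUncurryFin_apply, Fin.sum_univ_succ,
    Fin.cons_zero, Fin.cons_succ, Fin.val_zero, pow_zero, one_smul,
    ContinuousAlternatingMap.coe_zero, Pi.zero_apply, Fin.removeNth_zero, Fin.tail_cons] at h
  rw [eq_neg_of_add_eq_zero_left h, ← Finset.sum_neg_distrib]
  refine Finset.sum_congr rfl fun k _ ↦ ?_
  rcases p with - | q
  · exact k.elim0
  have e1 : k.succ.removeNth (Fin.cons w v : Fin (q + 2) → E) =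
      Matrix.vecCons w (k.removeNth v) := by
    ext i
    refine Fin.cases ?_ (fun j ↦ ?_) i
    · simp [Fin.removeNth]
    · simp [Fin.removeNth]
  rw [e1, ← Fin.insertNth_removeNth]
  have e2 := AlternatingMap.map_insertNth (fderiv ℝ θ y (v k)).toAlternatingMap k w (k.removeNth v)
  simp only [ContinuousAlternatingMap.coe_toAlternatingMap] at e2
  rw [e2, Fin.val_succ, pow_succ]
  simp

/-- Where the form `θ` attains its comass `1` on an orthonormal family `v`, its first order variation
in the base point is the one of the volume of `v`. -/
theorem fderiv_apply_eq_half_sum {G : E → E →L[ℝ] E →L[ℝ] ℝ} {θ : E → E [⋀^Fin p]→L[ℝ] ℝ} {y : E}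
    (hG : DifferentiableAt ℝ G y) (hθ : DifferentiableAt ℝ θ y)
    (hpair : ∀ᶠ z in 𝓝 y, IsCalibratingPair (G z) (θ z)) {v : Fin p → E}
    (hv : IsOrthonormalFor (fun a b ↦ G y a b) v) (h1 : θ y v = 1) (w : E) :
    fderiv ℝ θ y w v = (1 / 2 : ℝ) * ∑ k, fderiv ℝ G y w (v k) (v k) := by
  have hvv : ∀ i, G y (v i) (v i) = 1 := fun i ↦ by simpa using hv i i
  have hGi : ∀ i, HasFDerivAt (fun z ↦ √(G z (v i) (v i)))
      ((1 / (2 * √(G y (v i) (v i)))) •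
        ((fderiv ℝ G y).flip (v i)).flip (v i)) y := fun i ↦ by
    refine HasFDerivAt.sqrt ?_ (by simp [hvv])
    have := (hG.hasFDerivAt.clm_apply (hasFDerivAt_const (v i) y)).clm_apply
      (hasFDerivAt_const (v i) y)
    refine this.congr_fderiv ?_
    ext a
    simp
  have hprod := HasFDerivAt.finsetProd (u := Finset.univ) fun i _ ↦ hGi i
  have hθv : HasFDerivAt (fun z ↦ θ z v) ((fderiv ℝ θ y).flipAlternating v) y := by
    have := hθ.hasFDerivAt.continuousAlternatingMap_apply
      (g := fun i _ ↦ v i) fun i ↦ hasFDerivAt_const (v i) y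
    refine this.congr_fderiv ?_
    ext a
    simp
  -- Hadamard's inequality near `y`, an equality at `y`.
  have hmin : IsLocalMin (fun z ↦ (∏ i, √(G z (v i) (v i))) - θ z v) y := by
    filter_upwards [hpair] with z hz
    simpa [hvv, h1] using hz.apply_le v
  have h0 := congrArg (fun L ↦ L w) (hmin.hasFDerivAt_eq_zero (hprod.fun_sub hθv))
  simp [hvv] at h0
  rw [Finset.mul_sum]
  linarith

/-- The terms coming from the second derivative of the parametrization cancel in pairs. -/
theorem sum_sum_update_update_eq_zero (α : E [⋀^Fin p]→L[ℝ] ℝ) (v : Fin p → E) (w : E)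
    (S : Fin p → Fin p → E) (hS : ∀ i j, S i j = S j i) :
    ∑ k, ∑ i ∈ Finset.univ.erase k,
      α (Function.update (Function.update v k w) i (S k i)) = 0 := by
  let x : Fin p → Fin p → ℝ := fun k i ↦
    if i = k then 0 else α (Function.update (Function.update v k w) i (S k i))
  have hx : ∀ k, ∑ i ∈ Finset.univ.erase k,
      α (Function.update (Function.update v k w) i (S k i)) = ∑ i, x k i := by
    intro k
    rw [← Finset.sum_erase (Finset.univ) (a := k) (f := x k) (by simp [x])]
    exact Finset.sum_congr rfl fun i hi ↦ by simp [x, Finset.ne_of_mem_erase hi]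
  have hanti : ∀ k i, x k i = -x i k := by
    intro k i
    by_cases h : i = k
    · simp [x, h]
    · have h' : k ≠ i := fun e ↦ h e.symm
      simp only [x, h, h', if_false]
      rw [← ContinuousAlternatingMap.coe_toAlternatingMap,
        ← AlternatingMap.map_swap α.toAlternatingMap _ h, hS k i]
      congr 1
      ext l
      by_cases hl : l = i
      · subst hl; simp
      · by_cases hl' : l = k
        · subst hl'; simp [h', h]
        · simp [Equiv.swap_apply_of_ne_of_ne hl hl', hl, hl']
  simp only [hx]
  have h1 : ∑ k, ∑ i, x k i = -∑ k, ∑ i, x k i := by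
    conv_lhs => rw [Finset.sum_comm]
    simp only [← Finset.sum_neg_distrib]
    exact Finset.sum_congr rfl fun i _ ↦ Finset.sum_congr rfl fun k _ ↦ hanti k i
  linarith

/-- The metric induced by `G` on a parametrization `Φ`. -/
noncomputable def pullbackMetric (Φ : E' → E) (G : E → E →L[ℝ] E →L[ℝ] ℝ) (s : E') :
    E' →L[ℝ] E' →L[ℝ] ℝ :=
  (ContinuousLinearMap.precomp ℝ (fderiv ℝ Φ s)).comp ((G (Φ s)).comp (fderiv ℝ Φ s))

theorem pullbackMetric_apply (Φ : E' → E) (G : E → E →L[ℝ] E →L[ℝ] ℝ) (s a b : E') :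
    pullbackMetric Φ G s a b = G (Φ s) (fderiv ℝ Φ s a) (fderiv ℝ Φ s b) := rfl

section PullbackMetric

variable {Φ : E' → E} {G : E → E →L[ℝ] E →L[ℝ] ℝ} {s : E'}

theorem hasFDerivAt_fderiv (hΦ : ContDiffAt ℝ 2 Φ s) :
    HasFDerivAt (fderiv ℝ Φ) (fderiv ℝ (fderiv ℝ Φ) s) s :=
  ((hΦ.fderiv_right (m := 1) (by norm_num)).differentiableAt (by norm_num)).hasFDerivAt

theorem differentiableAt_pullbackMetric (hΦ : ContDiffAt ℝ 2 Φ s)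
    (hG : DifferentiableAt ℝ G (Φ s)) : DifferentiableAt ℝ (pullbackMetric Φ G) s := by
  have h1 := (hasFDerivAt_fderiv hΦ).differentiableAt
  have h2 : DifferentiableAt ℝ (fun s ↦ G (Φ s)) s :=
    hG.comp s (hΦ.differentiableAt (by norm_num))
  have h3 : DifferentiableAt ℝ (fun s ↦ (ContinuousLinearMap.compL ℝ E' E ℝ).flip (fderiv ℝ Φ s)) s :=
    (ContinuousLinearMap.differentiableAt _).comp s h1
  exact h3.clm_comp (h2.clm_comp h1)

theorem hasFDerivAt_metric_comp (hΦ : ContDiffAt ℝ 2 Φ s) (hG : DifferentiableAt ℝ G (Φ s)) :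
    HasFDerivAt (fun s ↦ G (Φ s)) ((fderiv ℝ G (Φ s)).comp (fderiv ℝ Φ s)) s :=
  hG.hasFDerivAt.comp s (hΦ.differentiableAt (by norm_num)).hasFDerivAt

theorem fderiv_pullbackMetric_apply (hΦ : ContDiffAt ℝ 2 Φ s) (hG : DifferentiableAt ℝ G (Φ s))
    (a b c : E') :
    fderiv ℝ (pullbackMetric Φ G) s a b c =
      fderiv ℝ G (Φ s) (fderiv ℝ Φ s a) (fderiv ℝ Φ s b) (fderiv ℝ Φ s c)
        + G (Φ s) (fderiv ℝ (fderiv ℝ Φ) s a b) (fderiv ℝ Φ s c)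
        + G (Φ s) (fderiv ℝ Φ s b) (fderiv ℝ (fderiv ℝ Φ) s a c) := by
  have h1 := ((differentiableAt_pullbackMetric hΦ hG).hasFDerivAt.clm_apply
    (hasFDerivAt_const b s)).clm_apply (hasFDerivAt_const c s)
  have hb := (hasFDerivAt_fderiv hΦ).clm_apply (hasFDerivAt_const b s)
  have hc := (hasFDerivAt_fderiv hΦ).clm_apply (hasFDerivAt_const c s)
  have h2 := ((hasFDerivAt_metric_comp hΦ hG).clm_apply hb).clm_apply hc
  have h3 := congrArg (fun L ↦ L a) (h1.unique h2)
  simp at h3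
  linarith

end PullbackMetric

theorem isInvertible_of_injective [FiniteDimensional ℝ E] {B : E →L[ℝ] E →L[ℝ] ℝ}
    (hB : Function.Injective B) : B.IsInvertible := by
  have hdim : Module.finrank ℝ E = Module.finrank ℝ (E →L[ℝ] ℝ) := by
    rw [← (LinearMap.toContinuousLinearMap (𝕜 := ℝ) (E := E) (F' := ℝ)).finrank_eq]
    exact (Subspace.dual_finrank_eq (K := ℝ) (V := E)).symm
  exact ⟨(LinearEquiv.ofInjectiveOfFinrankEq B.toLinearMap hB hdim).toContinuousLinearEquiv, rfl⟩

theorem isInvertible_of_pos [FiniteDimensional ℝ E] {B : E →L[ℝ] E →L[ℝ] ℝ}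
    (hB : ∀ a, a ≠ 0 → 0 < B a a) : B.IsInvertible := by
  refine isInvertible_of_injective ((injective_iff_map_eq_zero B).2 fun a ha ↦ ?_)
  by_contra h
  simpa [ha] using hB a h

end Coordinates

/-! ### Minimality of calibrated submanifolds in coordinates -/

section Minimality

variable {E : Type*} [NormedAddCommGroup E] [NormedSpace ℝ E]
  {E' : Type*} [NormedAddCommGroup E'] [NormedSpace ℝ E'] {p : ℕ}

theorem apply_basis_eq_repr {V : Type*} [AddCommGroup V] [Module ℝ V] (B : V →ₗ[ℝ] V →ₗ[ℝ] ℝ)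
    (e : Module.Basis (Fin p) ℝ V) (he : IsOrthonormalFor (fun u v ↦ B u v) e) (a : V) (k : Fin p) :
    B a (e k) = e.repr a k := by
  conv_lhs => rw [← e.sum_repr a]
  simp only [map_sum, map_smul, LinearMap.sum_apply, LinearMap.smul_apply, smul_eq_mul]
  rw [Finset.sum_eq_single k]
  · have := he k k
    simp only [if_true] at this
    rw [this, mul_one]
  · intro i _ hi
    have := he i k
    simp only [hi, if_false] at this
    rw [this, mul_zero]
  · simp

theorem isInvertible_of_orthonormal {B : E →L[ℝ] E →L[ℝ] ℝ} {e : Module.Basis (Fin p) ℝ E}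
    (he : IsOrthonormalFor (fun u v ↦ B u v) e) : B.IsInvertible := by
  have : FiniteDimensional ℝ E := e.finiteDimensional_of_finite
  refine isInvertible_of_injective ((injective_iff_map_eq_zero B).2 fun a ha ↦ ?_)
  refine e.ext_elem fun k ↦ ?_
  rw [← apply_basis_eq_repr B.toLinearMap₁₂ e he a k]
  simp [ha]

/-- The trace of the endomorphism which represents the bilinear form `H` with respect to the inner
product `B`, in a `B`-orthonormal basis. -/
theorem trace_inverse_comp {B H : E →L[ℝ] E →L[ℝ] ℝ} {e : Module.Basis (Fin p) ℝ E}
    (he : IsOrthonormalFor (fun u v ↦ B u v) e) :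
    LinearMap.trace ℝ E (B.inverse.comp H).toLinearMap = ∑ k, H (e k) (e k) := by
  rw [LinearMap.trace_eq_matrix_trace ℝ e, Matrix.trace]
  refine Finset.sum_congr rfl fun k _ ↦ ?_
  rw [Matrix.diag_apply, LinearMap.toMatrix_apply, ← apply_basis_eq_repr B.toLinearMap₁₂ e he]
  obtain ⟨L, hL⟩ := isInvertible_of_orthonormal he
  simp [← hL]

variable {Φ : E' → E} {G : E → E →L[ℝ] E →L[ℝ] ℝ} {θ : E → E [⋀^Fin p]→L[ℝ] ℝ} {s₀ : E'}

variable (hΦ : ContDiffAt ℝ 2 Φ s₀) (hG : DifferentiableAt ℝ G (Φ s₀))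
  (hθ : DifferentiableAt ℝ θ (Φ s₀))
  (hpair : ∀ᶠ y in 𝓝 (Φ s₀), IsCalibratingPair (G y) (θ y))
  (hcal : ∀ᶠ s in 𝓝 s₀, ∃ b : Module.Basis (Fin p) ℝ E',
    IsOrthonormalFor (fun u v ↦ pullbackMetric Φ G s u v) b ∧
      θ (Φ s) (fun i ↦ fderiv ℝ Φ s (b i)) = 1)
  {w : E} (hw : ∀ a, G (Φ s₀) w (fderiv ℝ Φ s₀ a) = 0)

include hΦ hG hcal hw in
/-- The tangential part `DΦ (c s)` of a fixed vector `w` along the submanifold is differentiable. If `w` is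
normal at `s₀`, it vanishes there, and its derivative does not involve the derivative of the induced
metric. -/
theorem exists_tangential_part : ∃ (c : E' → E') (c' : E' →L[ℝ] E'),
    HasFDerivAt c c' s₀ ∧ c s₀ = 0 ∧
    (∀ a b, pullbackMetric Φ G s₀ (c' a) b =
      fderiv ℝ G (Φ s₀) (fderiv ℝ Φ s₀ a) w (fderiv ℝ Φ s₀ b)
        + G (Φ s₀) w (fderiv ℝ (fderiv ℝ Φ) s₀ a b)) ∧
    ∀ᶠ s in 𝓝 s₀, ∀ a, pullbackMetric Φ G s (c s) a = G (Φ s) w (fderiv ℝ Φ s a) := by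
  have : FiniteDimensional ℝ E' := by
    obtain ⟨b, -⟩ := hcal.self_of_nhds
    exact b.finiteDimensional_of_finite
  have : CompleteSpace E' := FiniteDimensional.complete ℝ E'
  let h := pullbackMetric Φ G
  let b : E' → E' →L[ℝ] ℝ := fun s ↦ (G (Φ s) w).comp (fderiv ℝ Φ s)
  have hinv : ∀ᶠ s in 𝓝 s₀, (h s).IsInvertible := by
    filter_upwards [hcal] with s ⟨e, he, _⟩ using isInvertible_of_orthonormal he
  have hh : DifferentiableAt ℝ h s₀ := differentiableAt_pullbackMetric hΦ hG
  have hb : HasFDerivAt b _ s₀ := ((hasFDerivAt_metric_comp hΦ hG).clm_apply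
    (hasFDerivAt_const w s₀)).clm_comp (hasFDerivAt_fderiv hΦ)
  have hdi : DifferentiableAt ℝ (fun s ↦ (h s).inverse) s₀ :=
    (hinv.self_of_nhds.contDiffAt_map_inverse (n := 1)).differentiableAt (by norm_num)
      |>.comp s₀ hh
  let c : E' → E' := fun s ↦ (h s).inverse (b s)
  have hc : DifferentiableAt ℝ c s₀ := hdi.clm_apply hb.differentiableAt
  have hb0 : b s₀ = 0 := by
    ext a
    exact hw a
  have hc0 : c s₀ = 0 := by simp [c, hb0]
  have hcb : ∀ᶠ s in 𝓝 s₀, h s (c s) = b s := by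
    filter_upwards [hinv] with s hs
    obtain ⟨L, hL⟩ := hs
    simp [c, ← hL]
  refine ⟨c, fderiv ℝ c s₀, hc.hasFDerivAt, hc0, fun a d ↦ ?_, ?_⟩
  · have h1 := (hh.hasFDerivAt.clm_apply hc.hasFDerivAt).unique (hb.congr_of_eventuallyEq hcb)
    have h2 := congrArg (fun L ↦ L a d) h1
    simp [hc0] at h2
    rw [show pullbackMetric Φ G s₀ = h s₀ from rfl, h2]
    ring
  · filter_upwards [hcb] with s hs a
    exact congrArg (fun L ↦ L a) hs

variable {e : Module.Basis (Fin p) ℝ E'}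
  (he : IsOrthonormalFor (fun u v ↦ pullbackMetric Φ G s₀ u v) e)
  (he1 : θ (Φ s₀) (fun i ↦ fderiv ℝ Φ s₀ (e i)) = 1)

include hΦ hG hθ hpair hcal hw he he1 in
/-- The form `θ` vanishes on a tangent frame one member of which is replaced by a normal vector field.
This is the derivative of that identity along the submanifold, for the field given by the normal part of
the fixed vector `w`. -/
theorem fderiv_update_normal (k : Fin p) :
    fderiv ℝ θ (Φ s₀) (fderiv ℝ Φ s₀ (e k)) (Function.update (fun i ↦ fderiv ℝ Φ s₀ (e i)) k w)
      + ∑ i ∈ Finset.univ.erase k, θ (Φ s₀)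
        (Function.update (Function.update (fun i ↦ fderiv ℝ Φ s₀ (e i)) k w) i
          (fderiv ℝ (fderiv ℝ Φ) s₀ (e k) (e i)))
      = fderiv ℝ G (Φ s₀) (fderiv ℝ Φ s₀ (e k)) w (fderiv ℝ Φ s₀ (e k))
        + G (Φ s₀) w (fderiv ℝ (fderiv ℝ Φ) s₀ (e k) (e k)) := by
  obtain ⟨c, c', hc, hc0, hc', hcs⟩ := exists_tangential_part hΦ hG hcal hw
  let v : Fin p → E := fun i ↦ fderiv ℝ Φ s₀ (e i)
  have hev : IsOrthonormalFor (fun a b ↦ G (Φ s₀) a b) v := he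
  have hv1 : θ (Φ s₀) v = 1 := he1
  let W : E' → E := fun s ↦ w - fderiv ℝ Φ s (c s)
  have hW0 : W s₀ = w := by simp [W, hc0]
  have hW : HasFDerivAt W (-(fderiv ℝ Φ s₀).comp c') s₀ := by
    refine (((hasFDerivAt_fderiv hΦ).clm_apply hc).const_sub w).congr_fderiv ?_
    ext a
    simp [hc0]
  let f : Fin p → E' → E := fun i s ↦ if i = k then W s else fderiv ℝ Φ s (e i)
  let f' : Fin p → E' →L[ℝ] E := fun i ↦
    if i = k then -(fderiv ℝ Φ s₀).comp c' else (fderiv ℝ (fderiv ℝ Φ) s₀).flip (e i)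
  have hf : ∀ i, HasFDerivAt (f i) (f' i) s₀ := by
    intro i
    by_cases hi : i = k
    · simpa [f, f', hi] using hW
    · simp only [f, f', hi, if_false]
      refine ((hasFDerivAt_fderiv hΦ).clm_apply (hasFDerivAt_const (e i) s₀)).congr_fderiv ?_
      ext a
      simp
  have hfs : ∀ s, (fun i ↦ f i s) = Function.update (fun i ↦ fderiv ℝ Φ s (e i)) k (W s) := by
    intro s
    ext i
    by_cases hi : i = k
    · subst hi; simp [f]
    · simp [f, hi]
  have hθΦ : HasFDerivAt (fun s ↦ θ (Φ s)) ((fderiv ℝ θ (Φ s₀)).comp (fderiv ℝ Φ s₀)) s₀ :=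
    hθ.hasFDerivAt.comp s₀ (hΦ.differentiableAt (by norm_num)).hasFDerivAt
  have hder := hθΦ.continuousAlternatingMap_apply hf
  have hzero : (fun s ↦ θ (Φ s) fun i ↦ f i s) =ᶠ[𝓝 s₀] fun _ ↦ (0 : ℝ) := by
    filter_upwards [hcal, hΦ.continuousAt.eventually hpair, hcs] with s ⟨b, hb, hb1⟩ hs hcs
    rw [hfs s]
    refine apply_update_eq_zero_of_basis (θ (Φ s)).toAlternatingMap (fderiv ℝ Φ s).toLinearMap b
      (W s) (fun l ↦ ?_) e k
    refine (hs.apply_update hb hb1 l (W s)).trans ?_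
    rw [hs.symm]
    have := hcs (b l)
    rw [pullbackMetric_apply] at this
    simp [W, this]
  have h0 := congrArg (fun L ↦ L (e k))
    (hder.unique ((hasFDerivAt_const (0 : ℝ) s₀).congr_of_eventuallyEq hzero))
  simp only [hfs s₀, hW0, add_apply, ContinuousLinearMap.comp_apply,
    sum_apply, zero_apply,
    ContinuousAlternatingMap.apply_apply, ContinuousAlternatingMap.toContinuousLinearMap_apply] at h0
  rw [← Finset.add_sum_erase _ _ (Finset.mem_univ k)] at h0
  have hk : θ (Φ s₀) (Function.update (Function.update v k w) k (f' k (e k))) =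
      -(fderiv ℝ G (Φ s₀) (fderiv ℝ Φ s₀ (e k)) w (fderiv ℝ Φ s₀ (e k))
        + G (Φ s₀) w (fderiv ℝ (fderiv ℝ Φ) s₀ (e k) (e k))) := by
    rw [Function.update_idem, hpair.self_of_nhds.apply_update hev hv1, hpair.self_of_nhds.symm,
      ← hc', pullbackMetric_apply]
    simp [f', v]
  have hi : ∀ i ∈ Finset.univ.erase k,
      θ (Φ s₀) (Function.update (Function.update v k w) i (f' i (e k))) =
      θ (Φ s₀) (Function.update (Function.update v k w) i
        (fderiv ℝ (fderiv ℝ Φ) s₀ (e k) (e i))) := by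
    intro i hi
    simp [f', Finset.ne_of_mem_erase hi]
  rw [hk, Finset.sum_congr rfl hi] at h0
  linarith

variable (hclosed : extDeriv θ (Φ s₀) = 0)

include hΦ hG hθ hpair hcal hw he he1 hclosed in
/-- The mean curvature vector of a calibrated submanifold has no component along a normal vector `w`. -/
theorem sum_normal_eq_zero :
    ∑ k, (G (Φ s₀) w (fderiv ℝ (fderiv ℝ Φ) s₀ (e k) (e k))
      + christoffelLower G (Φ s₀) (fderiv ℝ Φ s₀ (e k)) (fderiv ℝ Φ s₀ (e k)) w) = 0 := by
  let v : Fin p → E := fun i ↦ fderiv ℝ Φ s₀ (e i)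
  have hev : IsOrthonormalFor (fun a b ↦ G (Φ s₀) a b) v := he
  have hv1 : θ (Φ s₀) v = 1 := he1
  have hsymm : IsSymmSndFDerivAt ℝ Φ s₀ := hΦ.isSymmSndFDerivAt (by simp)
  have hA := fderiv_apply_eq_half_sum hG hθ hpair hev hv1 w
  have hB := fderiv_apply_eq_sum_of_extDeriv_eq_zero hclosed w v
  have hC := Finset.sum_congr rfl fun k (_ : k ∈ Finset.univ) ↦
    fderiv_update_normal hΦ hG hθ hpair hcal hw he he1 k
  rw [Finset.sum_add_distrib, sum_sum_update_update_eq_zero _ _ _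
    (fun k i ↦ fderiv ℝ (fderiv ℝ Φ) s₀ (e k) (e i)) (fun i j ↦ hsymm _ _), add_zero, ← hB, hA,
    Finset.mul_sum] at hC
  have hGs : ∀ x a b, fderiv ℝ G (Φ s₀) x a b = fderiv ℝ G (Φ s₀) x b a := by
    intro x a b
    have h1 := (hG.hasFDerivAt.clm_apply (hasFDerivAt_const a _)).clm_apply (hasFDerivAt_const b _)
    have h2 := (hG.hasFDerivAt.clm_apply (hasFDerivAt_const b _)).clm_apply (hasFDerivAt_const a _)
    have h3 : (fun y ↦ G y a b) =ᶠ[𝓝 (Φ s₀)] fun y ↦ G y b a := by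
      filter_upwards [hpair] with y hy using hy.symm a b
    have h4 := congrArg (fun L ↦ L x) (h1.unique (h2.congr_of_eventuallyEq h3))
    simpa using h4
  rw [← sub_eq_zero, ← Finset.sum_sub_distrib] at hC
  rw [← neg_eq_zero, ← Finset.sum_neg_distrib, ← hC]
  refine Finset.sum_congr rfl fun k _ ↦ ?_
  rw [christoffelLower_apply, hGs _ w]
  ring

end Minimality

/-! ### Traces of Hessians on calibrated submanifolds in coordinates -/

section HessianTrace

variable {E : Type*} [NormedAddCommGroup E] [NormedSpace ℝ E]
  {E' : Type*} [NormedAddCommGroup E'] [NormedSpace ℝ E'] {p : ℕ}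
  {Φ : E' → E} {G : E → E →L[ℝ] E →L[ℝ] ℝ} {s₀ : E'}

theorem fderiv_fderiv_comp_apply {F : E → ℝ} (hΦ : ContDiffAt ℝ 2 Φ s₀)
    (hF : ContDiffAt ℝ 2 F (Φ s₀)) (a b : E') :
    fderiv ℝ (fderiv ℝ (F ∘ Φ)) s₀ a b =
      fderiv ℝ (fderiv ℝ F) (Φ s₀) (fderiv ℝ Φ s₀ a) (fderiv ℝ Φ s₀ b)
        + fderiv ℝ F (Φ s₀) (fderiv ℝ (fderiv ℝ Φ) s₀ a b) := by
  have hev : fderiv ℝ (F ∘ Φ) =ᶠ[𝓝 s₀] fun s ↦ (fderiv ℝ F (Φ s)).comp (fderiv ℝ Φ s) := by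
    filter_upwards [hΦ.eventually (by simp), hΦ.continuousAt.eventually (hF.eventually (by simp))]
      with s hs hs'
    exact fderiv_comp s (hs'.differentiableAt (by norm_num)) (hs.differentiableAt (by norm_num))
  have h1 := ((hasFDerivAt_fderiv hF).comp s₀
    (hΦ.differentiableAt (by norm_num)).hasFDerivAt).clm_comp (hasFDerivAt_fderiv hΦ)
  have h2 := h1.congr_of_eventuallyEq hev
  rw [h2.fderiv]
  simp [add_comm]

/-- Gauss formula: the second fundamental form of a parametrized submanifold is normal. -/
theorem apply_secondFundamentalForm_tangent (hΦ : ContDiffAt ℝ 2 Φ s₀)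
    (hG : DifferentiableAt ℝ G (Φ s₀)) (hsymm : ∀ᶠ y in 𝓝 (Φ s₀), ∀ u v, G y u v = G y v u)
    (hGinv : (G (Φ s₀)).IsInvertible) (hinv : (pullbackMetric Φ G s₀).IsInvertible) (a b : E') :
    G (Φ s₀) (fderiv ℝ (fderiv ℝ Φ) s₀ a a
      + christoffel G (Φ s₀) (fderiv ℝ Φ s₀ a) (fderiv ℝ Φ s₀ a)
      - fderiv ℝ Φ s₀ (christoffel (pullbackMetric Φ G) s₀ a a)) (fderiv ℝ Φ s₀ b) = 0 := by
  have hD : IsSymmSndFDerivAt ℝ Φ s₀ := hΦ.isSymmSndFDerivAt (by simp)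
  have h := apply_christoffel (pullbackMetric Φ G) s₀ hinv a a b
  rw [pullbackMetric_apply, christoffelLower_apply, fderiv_pullbackMetric_apply hΦ hG,
    fderiv_pullbackMetric_apply hΦ hG, hD.eq b a] at h
  rw [map_sub, map_add, sub_apply, add_apply, apply_christoffel G _ hGinv, h,
    christoffelLower_apply]
  have hs := hsymm.self_of_nhds
  rw [hs (fderiv ℝ (fderiv ℝ Φ) s₀ a b) (fderiv ℝ Φ s₀ a)]
  ring

variable [FiniteDimensional ℝ E] {θ : E → E [⋀^Fin p]→L[ℝ] ℝ} {F : E → ℝ}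

/-- For a calibrated submanifold, the trace of the intrinsic Hessian of the restriction of a function
equals the trace over the tangent space of the ambient Hessian, because the second fundamental form
has vanishing trace. -/
theorem sum_coordHessian_comp (hΦ : ContDiffAt ℝ 2 Φ s₀) (hG : DifferentiableAt ℝ G (Φ s₀))
    (hθ : DifferentiableAt ℝ θ (Φ s₀))
    (hpair : ∀ᶠ y in 𝓝 (Φ s₀), IsCalibratingPair (G y) (θ y))
    (hcal : ∀ᶠ s in 𝓝 s₀, ∃ b : Module.Basis (Fin p) ℝ E',
      IsOrthonormalFor (fun u v ↦ pullbackMetric Φ G s u v) b ∧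
        θ (Φ s) (fun i ↦ fderiv ℝ Φ s (b i)) = 1)
    (hclosed : extDeriv θ (Φ s₀) = 0) (hF : ContDiffAt ℝ 2 F (Φ s₀))
    {e : Module.Basis (Fin p) ℝ E'}
    (he : IsOrthonormalFor (fun u v ↦ pullbackMetric Φ G s₀ u v) e)
    (he1 : θ (Φ s₀) (fun i ↦ fderiv ℝ Φ s₀ (e i)) = 1) :
    ∑ k, coordHessian (pullbackMetric Φ G) (F ∘ Φ) s₀ (e k) (e k) =
      ∑ k, coordHessian G F (Φ s₀) (fderiv ℝ Φ s₀ (e k)) (fderiv ℝ Φ s₀ (e k)) := by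
  have hp := hpair.self_of_nhds
  have hGinv : (G (Φ s₀)).IsInvertible := isInvertible_of_pos hp.pos
  have hinv := isInvertible_of_orthonormal he
  let N : E := ∑ k, (fderiv ℝ (fderiv ℝ Φ) s₀ (e k) (e k)
      + christoffel G (Φ s₀) (fderiv ℝ Φ s₀ (e k)) (fderiv ℝ Φ s₀ (e k))
      - fderiv ℝ Φ s₀ (christoffel (pullbackMetric Φ G) s₀ (e k) (e k)))
  have htan : ∀ b, G (Φ s₀) N (fderiv ℝ Φ s₀ b) = 0 := by
    intro b
    simp only [N, map_sum, sum_apply]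
    refine Finset.sum_eq_zero fun k _ ↦ apply_secondFundamentalForm_tangent hΦ hG ?_ hGinv hinv _ _
    filter_upwards [hpair] with y hy using hy.symm
  have hnor : ∀ w, (∀ a, G (Φ s₀) w (fderiv ℝ Φ s₀ a) = 0) → G (Φ s₀) N w = 0 := by
    intro w hw
    rw [← sum_normal_eq_zero hΦ hG hθ hpair hcal hw he he1 hclosed]
    simp only [N, map_sum, sum_apply]
    refine Finset.sum_congr rfl fun k _ ↦ ?_
    rw [map_sub, map_add, sub_apply, add_apply, apply_christoffel G _ hGinv,
      hp.symm (fderiv ℝ Φ s₀ _) w, hw, hp.symm w, sub_zero]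
  have hN : N = 0 := by
    by_contra hN
    -- `N` is normal, so that the minimality applies to `w = N`.
    exact (hp.pos N hN).ne' (hnor N htan)
  have hFN : fderiv ℝ F (Φ s₀) N = 0 := by rw [hN, map_zero]
  rw [← sub_eq_zero, ← Finset.sum_sub_distrib, ← hFN]
  simp only [N, map_sum]
  refine Finset.sum_congr rfl fun k _ ↦ ?_
  rw [coordHessian_apply, coordHessian_apply, fderiv_fderiv_comp_apply hΦ hF, map_sub, map_add,
    fderiv_comp s₀ (hF.differentiableAt (by norm_num)) (hΦ.differentiableAt (by norm_num))]
  simp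
  ring

end HessianTrace

/-! ### Pullbacks of tensor fields and their expressions in charts -/

section Pullback

variable {E : Type*} [NormedAddCommGroup E] [NormedSpace ℝ E]
  {X : Type*} [TopologicalSpace X] [ChartedSpace E X]
  {E' : Type*} [NormedAddCommGroup E'] [NormedSpace ℝ E']
  {Y : Type*} [TopologicalSpace Y] [ChartedSpace E' Y]
  {E'' : Type*} [NormedAddCommGroup E''] [NormedSpace ℝ E'']
  {Z : Type*} [TopologicalSpace Z] [ChartedSpace E'' Z] {p : ℕ}

theorem pullbackBilin_comp {F : Y → X} {H : Z → Y} (g : BilinField E X) {z : Z}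
    (hF : MDifferentiableAt 𝓘(ℝ, E') 𝓘(ℝ, E) F (H z))
    (hH : MDifferentiableAt 𝓘(ℝ, E'') 𝓘(ℝ, E') H z) :
    pullbackBilin (E' := E'') (F ∘ H) g z =
      pullbackBilin (E := E') (E' := E'') H (pullbackBilin (E' := E') F g) z := by
  ext u v
  simp only [pullbackBilin_apply, mfderiv_comp z hF hH]
  rfl

theorem pullbackForm_comp {F : Y → X} {H : Z → Y} (φ : FormField E X p) {z : Z}
    (hF : MDifferentiableAt 𝓘(ℝ, E') 𝓘(ℝ, E) F (H z))
    (hH : MDifferentiableAt 𝓘(ℝ, E'') 𝓘(ℝ, E') H z) :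
    pullbackForm (E' := E'') (F ∘ H) φ z =
      pullbackForm (E := E') (E' := E'') H (pullbackForm (E' := E') F φ) z := by
  ext v
  simp only [pullbackForm, mfderiv_comp z hF hH]
  rfl

theorem pullbackBilin_congr {F F' : Y → X} (g : BilinField E X) {y : Y} (h : F =ᶠ[𝓝 y] F') :
    pullbackBilin (E' := E') F g y = pullbackBilin (E' := E') F' g y := by
  let Q : X → (E' →L[ℝ] E) → E' →L[ℝ] E' →L[ℝ] ℝ := fun x L ↦
    (ContinuousLinearMap.precomp ℝ L).comp ((g x : E →L[ℝ] E →L[ℝ] ℝ).comp L)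
  exact congrArg₂ Q h.eq_of_nhds (h.mfderiv_eq (I := 𝓘(ℝ, E')) (I' := 𝓘(ℝ, E)))

theorem pullbackForm_congr {F F' : Y → X} (φ : FormField E X p) {y : Y} (h : F =ᶠ[𝓝 y] F') :
    pullbackForm (E' := E') F φ y = pullbackForm (E' := E') F' φ y := by
  let Q : X → (E' →L[ℝ] E) → E' [⋀^Fin p]→L[ℝ] ℝ := fun x L ↦
    (φ x : E [⋀^Fin p]→L[ℝ] ℝ).compContinuousLinearMap L
  exact congrArg₂ Q h.eq_of_nhds (h.mfderiv_eq (I := 𝓘(ℝ, E')) (I' := 𝓘(ℝ, E)))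

theorem pullbackBilin_id (g : BilinField E X) (x : X) : pullbackBilin id g x = g x := by
  ext u v
  simp only [pullbackBilin_apply, mfderiv_id]
  rfl

theorem pullbackForm_id (φ : FormField E X p) (x : X) : pullbackForm id φ x = φ x := by
  ext v
  simp only [pullbackForm, mfderiv_id]
  rfl

theorem pullbackMetric_eq_pullbackBilin (Φ : E' → E) (G : E → E →L[ℝ] E →L[ℝ] ℝ) (s : E') :
    pullbackMetric Φ G s = pullbackBilin (X := E) (Y := E') Φ G s := by
  unfold pullbackBilin
  rw [mfderiv_eq_fderiv]
  rfl

section Charts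

theorem extChartAt_symm_comp_extChartAt {x₀ x : X} (hx : x ∈ (extChartAt 𝓘(ℝ, E) x₀).source) :
    (extChartAt 𝓘(ℝ, E) x₀).symm ∘ extChartAt 𝓘(ℝ, E) x₀ =ᶠ[𝓝 x] id := by
  filter_upwards [(isOpen_extChartAt_source (I := 𝓘(ℝ, E)) x₀).mem_nhds hx] with z hz
    using (extChartAt 𝓘(ℝ, E) x₀).left_inv hz

variable [IsManifold 𝓘(ℝ, E) ∞ X]

theorem mdifferentiableAt_extChartAt_symm {x₀ : X} {y : E}
    (hy : y ∈ (extChartAt 𝓘(ℝ, E) x₀).target) :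
    MDifferentiableAt 𝓘(ℝ, E) 𝓘(ℝ, E) (extChartAt 𝓘(ℝ, E) x₀).symm y := by
  simpa [mdifferentiableWithinAt_univ] using
    mdifferentiableWithinAt_extChartAt_symm (I := 𝓘(ℝ, E)) hy

theorem mdifferentiableAt_extChartAt' {x₀ x : X} (hx : x ∈ (extChartAt 𝓘(ℝ, E) x₀).source) :
    MDifferentiableAt 𝓘(ℝ, E) 𝓘(ℝ, E) (extChartAt 𝓘(ℝ, E) x₀) x :=
  mdifferentiableAt_extChartAt (by simpa using hx)

theorem pullbackBilin_coordBilin (g : BilinField E X) {x₀ x : X}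
    (hx : x ∈ (extChartAt 𝓘(ℝ, E) x₀).source) :
    pullbackBilin (X := E) (extChartAt 𝓘(ℝ, E) x₀) (coordBilin g x₀) x = g x := by
  rw [← pullbackBilin_id g x, ← pullbackBilin_congr g (extChartAt_symm_comp_extChartAt hx)]
  exact (pullbackBilin_comp g (mdifferentiableAt_extChartAt_symm
    ((extChartAt 𝓘(ℝ, E) x₀).map_source hx)) (mdifferentiableAt_extChartAt' hx)).symm

theorem pullbackForm_coordForm (φ : FormField E X p) {x₀ x : X}
    (hx : x ∈ (extChartAt 𝓘(ℝ, E) x₀).source) :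
    pullbackForm (X := E) (extChartAt 𝓘(ℝ, E) x₀) (coordForm φ x₀) x = φ x := by
  rw [← pullbackForm_id φ x, ← pullbackForm_congr φ (extChartAt_symm_comp_extChartAt hx)]
  exact (pullbackForm_comp φ (mdifferentiableAt_extChartAt_symm
    ((extChartAt 𝓘(ℝ, E) x₀).map_source hx)) (mdifferentiableAt_extChartAt' hx)).symm

/-- The derivative of a chart, as an isomorphism of the tangent space with the model space. -/
noncomputable def chartEquiv {x₀ x : X} (hx : x ∈ (extChartAt 𝓘(ℝ, E) x₀).source) :
    TangentSpace 𝓘(ℝ, E) x ≃L[ℝ] E :=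
  (isInvertible_mfderiv_extChartAt (I := 𝓘(ℝ, E)) hx).choose

theorem chartEquiv_apply {x₀ x : X} (hx : x ∈ (extChartAt 𝓘(ℝ, E) x₀).source)
    (v : TangentSpace 𝓘(ℝ, E) x) :
    chartEquiv hx v = mfderiv 𝓘(ℝ, E) 𝓘(ℝ, E) (extChartAt 𝓘(ℝ, E) x₀) x v :=
  congrArg (fun L ↦ L v) (isInvertible_mfderiv_extChartAt (I := 𝓘(ℝ, E)) hx).choose_spec

/-- In a chart, a calibration is a form of comass at most one for the metric of the chart. -/
theorem isCalibratingPair_coord {g : Metric E X} {φ : FormField E X p} (hφ : IsCalibration g φ)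
    {x₀ : X} {y : E} (hy : y ∈ (extChartAt 𝓘(ℝ, E) x₀).target) :
    IsCalibratingPair (coordBilin g.inner x₀ y) (coordForm φ x₀ y) where
  symm u v := by
    rw [coordBilin_apply, coordBilin_apply, g.symm]
  pos v hv := by
    rw [coordBilin_apply]
    refine g.pos _ _ fun h ↦ hv ?_
    have hi := isInvertible_mfderivWithin_extChartAt_symm (I := 𝓘(ℝ, E)) hy
    simp only [modelWithCornersSelf_coe, Set.range_id, mfderivWithin_univ] at hi
    obtain ⟨L, hL⟩ := hi
    have : L v = 0 := by rw [← h, ← hL]; rfl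
    exact L.map_eq_zero_iff.1 this
  comass_le v hv := by
    rw [coordForm_apply]
    have := hφ.comass_le _ _ ⟨_, hv, rfl⟩
    rwa [evalPVector_ιMulti] at this

theorem differentiableAt_coordBilin (g : Metric E X) (x₀ : X) :
    DifferentiableAt ℝ (coordBilin g.inner x₀) (extChartAt 𝓘(ℝ, E) x₀ x₀) := by
  have h := ((contMDiffAt_hom_bundle _).1 (g.contMDiff x₀)).2
  have hχ : ContMDiffAt 𝓘(ℝ, E) 𝓘(ℝ, E) ∞ (extChartAt 𝓘(ℝ, E) x₀).symm
      (extChartAt 𝓘(ℝ, E) x₀ x₀) :=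
    (contMDiffOn_extChartAt_symm x₀).contMDiffAt (extChartAt_target_mem_nhds x₀)
  have h2 :=
    (ContMDiffAt.comp_of_eq h hχ (extChartAt_to_inv x₀)).contDiffAt.differentiableAt (by simp)
  refine h2.congr_of_eventuallyEq ?_
  filter_upwards [extChartAt_target_mem_nhds (I := 𝓘(ℝ, E)) x₀] with y hy
  have hs : (extChartAt 𝓘(ℝ, E) x₀).symm y ∈ (chartAt E x₀).source := by
    simpa using (extChartAt 𝓘(ℝ, E) x₀).map_target hy
  have hL := TangentBundle.symmL_trivializationAt (I := 𝓘(ℝ, E)) hs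
  rw [(extChartAt 𝓘(ℝ, E) x₀).right_inv hy] at hL
  simp only [modelWithCornersSelf_coe, Set.range_id, mfderivWithin_univ] at hL
  ext u v
  rw [coordBilin_apply, ← hL]
  simp only [Function.comp_apply]
  rw [inCoordinates_apply_eq₂ (by simpa using hs) (by simpa using hs) (Set.mem_univ _)]
  simp only [Bundle.Trivial.linearMapAt_trivialization, Bundle.Trivial.fiberBundle_trivializationAt',
    LinearMap.id_apply]
  exact congrArg₂ (fun a b ↦ g.inner ((extChartAt 𝓘(ℝ, E) x₀).symm y) a b)
    (Bundle.Trivialization.symmL_apply _ (by simpa using hs) u)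
    (Bundle.Trivialization.symmL_apply _ (by simpa using hs) v)

end Charts

end Pullback

/-! ### The Laplacian on a calibrated submanifold and the `φ`-Hessian -/

section Submanifold

theorem coordHessian_congr {E : Type*} [NormedAddCommGroup E] [NormedSpace ℝ E]
    {G G' : E → E →L[ℝ] E →L[ℝ] ℝ} {F F' : E → ℝ} {y : E} (hG : G =ᶠ[𝓝 y] G')
    (hF : F =ᶠ[𝓝 y] F') : coordHessian G F y = coordHessian G' F' y := by
  have hF' : fderiv ℝ F =ᶠ[𝓝 y] fderiv ℝ F' := hF.fderiv
  simp only [coordHessian, christoffel, christoffelLower, hF'.fderiv_eq, hF.fderiv_eq,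
    hG.fderiv_eq, hG.eq_of_nhds]

universe u

variable {E : Type*} [NormedAddCommGroup E] [NormedSpace ℝ E]
  {X : Type u} [TopologicalSpace X] [ChartedSpace E X] {p : ℕ}

variable (M : OrientedSubmanifold E X p)

/-- The inclusion of a submanifold, in the charts at `m` and at its image. -/
noncomputable def OrientedSubmanifold.coordIncl (m : M.carrier) (s : EuclideanSpace ℝ (Fin p)) : E :=
  extChartAt 𝓘(ℝ, E) (M.incl m) (M.incl ((extChartAt (𝓡 p) m).symm s))

namespace OrientedSubmanifold

theorem contMDiff_incl : ContMDiff (𝓡 p) 𝓘(ℝ, E) ∞ M.incl :=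
  M.isSmoothEmbedding.contMDiff

theorem coordIncl_extChartAt (m : M.carrier) :
    M.coordIncl m (extChartAt (𝓡 p) m m) = extChartAt 𝓘(ℝ, E) (M.incl m) (M.incl m) := by
  rw [coordIncl, extChartAt_to_inv]

/-- Near the base point, the image under the inclusion lies in the chart of `X`. -/
theorem eventually_incl_mem (m : M.carrier) : ∀ᶠ s in 𝓝 (extChartAt (𝓡 p) m m),
    s ∈ (extChartAt (𝓡 p) m).target ∧
      M.incl ((extChartAt (𝓡 p) m).symm s) ∈ (extChartAt 𝓘(ℝ, E) (M.incl m)).source := by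
  have h1 := extChartAt_target_mem_nhds (I := 𝓡 p) m
  have h2 : Filter.Tendsto (fun s ↦ M.incl ((extChartAt (𝓡 p) m).symm s))
      (𝓝 (extChartAt (𝓡 p) m m)) (𝓝 (M.incl m)) := by
    have := (continuousAt_extChartAt_symm (I := 𝓡 p) m).tendsto
    rw [extChartAt_to_inv] at this
    exact (M.contMDiff_incl.continuous.tendsto m).comp this
  filter_upwards [h1, h2 (extChartAt_source_mem_nhds (I := 𝓘(ℝ, E)) (M.incl m))] with s hs hs'
    using ⟨hs, hs'⟩

theorem extChartAt_symm_coordIncl (m : M.carrier) : ∀ᶠ s in 𝓝 (extChartAt (𝓡 p) m m),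
    (extChartAt 𝓘(ℝ, E) (M.incl m)).symm (M.coordIncl m s) =
      M.incl ((extChartAt (𝓡 p) m).symm s) := by
  filter_upwards [M.eventually_incl_mem m] with s hs
    using (extChartAt 𝓘(ℝ, E) (M.incl m)).left_inv hs.2

theorem contDiffAt_coordIncl (m : M.carrier) :
    ContDiffAt ℝ 2 (M.coordIncl m) (extChartAt (𝓡 p) m m) := by
  have := ((contMDiffAt_iff (I := 𝓡 p) (I' := 𝓘(ℝ, E))).1 (M.contMDiff_incl m)).2
  rw [modelWithCornersSelf_coe, Set.range_id, contDiffWithinAt_univ] at this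
  exact this.of_le (by norm_cast)

variable [IsManifold 𝓘(ℝ, E) ∞ X] (g : Metric E X) (φ : FormField E X p)

/-- In charts, pulling back the metric and the form of the ambient chart by `coordIncl` gives the induced
metric and the restricted form. -/
theorem eventually_coord_eq (m : M.carrier) : ∀ᶠ s in 𝓝 (extChartAt (𝓡 p) m m),
    pullbackMetric (M.coordIncl m) (coordBilin g.inner (M.incl m)) s =
      coordBilin (M.inducedMetric g) m s ∧
    pullbackForm (Y := EuclideanSpace ℝ (Fin p)) (X := E) (M.coordIncl m)
        (coordForm φ (M.incl m)) s =
      coordForm (pullbackForm M.incl φ) m s := by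
  filter_upwards [M.eventually_incl_mem m, (M.extChartAt_symm_coordIncl m).eventually_nhds,
    (M.contDiffAt_coordIncl m).eventually (by simp)] with s ⟨hs1, hs2⟩ hs3 hs4
  have hd1 : MDifferentiableAt 𝓘(ℝ, E) 𝓘(ℝ, E) (extChartAt 𝓘(ℝ, E) (M.incl m)).symm
      (M.coordIncl m s) :=
    mdifferentiableAt_extChartAt_symm ((extChartAt 𝓘(ℝ, E) (M.incl m)).map_source hs2)
  have hd2 : MDifferentiableAt (𝓡 p) 𝓘(ℝ, E) (M.coordIncl m) s :=
    (hs4.differentiableAt (by simp)).mdifferentiableAt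
  have hd3 : MDifferentiableAt (𝓡 p) (𝓡 p) (extChartAt (𝓡 p) m).symm s :=
    mdifferentiableAt_extChartAt_symm hs1
  have hd4 : MDifferentiableAt (𝓡 p) 𝓘(ℝ, E) M.incl ((extChartAt (𝓡 p) m).symm s) :=
    (M.contMDiff_incl _).mdifferentiableAt (by simp)
  have hev : (extChartAt 𝓘(ℝ, E) (M.incl m)).symm ∘ M.coordIncl m =ᶠ[𝓝 s]
      M.incl ∘ (extChartAt (𝓡 p) m).symm := hs3
  constructor
  · rw [pullbackMetric_eq_pullbackBilin]
    exact (pullbackBilin_comp g.inner hd1 hd2).symm.trans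
      ((pullbackBilin_congr g.inner hev).trans (pullbackBilin_comp g.inner hd4 hd3))
  · exact (pullbackForm_comp φ hd1 hd2).symm.trans
      ((pullbackForm_congr φ hev).trans (pullbackForm_comp φ hd4 hd3))

/-- The chart at `m` carries a calibrated frame at a nearby point to a calibrated frame of the model
space. -/
theorem orthonormal_chart {m m' : M.carrier} (hm' : m' ∈ (extChartAt (𝓡 p) m).source)
    {e : Module.Basis (Fin p) ℝ (TangentSpace (𝓡 p) m')}
    (he : IsOrthonormalFor (fun u v ↦ M.inducedMetric g m' u v) e)
    (h1 : φ (M.incl m') (fun i ↦ mfderiv (𝓡 p) 𝓘(ℝ, E) M.incl m' (e i)) = 1) :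
    IsOrthonormalFor (fun u v ↦ coordBilin (M.inducedMetric g) m (extChartAt (𝓡 p) m m') u v)
      (e.map (chartEquiv hm').toLinearEquiv) ∧
    coordForm (pullbackForm M.incl φ) m (extChartAt (𝓡 p) m m')
      (e.map (chartEquiv hm').toLinearEquiv) = 1 := by
  have hb : ∀ i, e.map (chartEquiv hm').toLinearEquiv i =
      mfderiv (𝓡 p) (𝓡 p) (extChartAt (𝓡 p) m) m' (e i) := fun i ↦ by
    rw [Module.Basis.map_apply]
    exact chartEquiv_apply hm' (e i)
  constructor
  · intro i j
    rw [hb, hb, ← he i j, ← pullbackBilin_coordBilin (M.inducedMetric g) hm']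
    rfl
  · rw [show ⇑(e.map (chartEquiv hm').toLinearEquiv) = _ from funext hb]
    have := congrArg (fun α ↦ α e) (pullbackForm_coordForm (pullbackForm M.incl φ) hm')
    exact this.trans h1

end OrientedSubmanifold

/-- The first cousin principle identifies the `φ`-Hessian on a `φ`-plane with the trace of the Hessian
over this plane. -/
theorem evalPVector_phiHessian [FiniteDimensional ℝ E] [IsManifold 𝓘(ℝ, E) ∞ X] {g : Metric E X}
    {φ : FormField E X p}
    (hφ : IsCalibration g φ) (f : X → ℝ) {x : X} {v : Fin p → TangentSpace 𝓘(ℝ, E) x}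
    (hv : IsOrthonormalFor (fun a b ↦ g.inner x a b) v) (h1 : φ x v = 1) :
    evalPVector (phiHessian g φ f x) (exteriorPower.ιMulti ℝ p v) =
      ∑ k, hessian g.inner f x (v k) (v k) := by
  rw [evalPVector_ιMulti]
  change ∑ k, φ x (Function.update v k (hessianEnd g.inner f x (v k))) = _
  refine Finset.sum_congr rfl fun k _ ↦ ?_
  refine (apply_update_eq (V := TangentSpace 𝓘(ℝ, E) x)
    (ContinuousLinearMap.toLinearMap₁₂ (g.inner x)) (g.symm x) (g.pos x) (φ x).toAlternatingMap
    (fun w hw ↦ ?_) hv h1 k _).trans ?_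
  · rw [← evalPVector_ιMulti]
    exact hφ.comass_le x _ ⟨w, hw, rfl⟩
  · have hinv : (show E →L[ℝ] E →L[ℝ] ℝ from g.inner x).IsInvertible :=
      isInvertible_of_pos (g.pos x)
    obtain ⟨L, hL⟩ := hinv
    refine (g.symm x _ _).trans ?_
    have : ∀ a : E →L[ℝ] ℝ, (show E →L[ℝ] E →L[ℝ] ℝ from g.inner x)
        ((show E →L[ℝ] E →L[ℝ] ℝ from g.inner x).inverse a) = a := by
      intro a
      simp [← hL]
    exact congrArg (fun l ↦ l (v k)) (this (hessian g.inner f x (v k)))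

/-- On a calibrated submanifold the Laplacian of the restriction of `f` is the value of the `φ`-Hessian
of `f` on the tangent `φ`-plane. -/
theorem laplacian_comp_incl_eq [FiniteDimensional ℝ E] [IsManifold 𝓘(ℝ, E) ∞ X] {g : Metric E X}
    {φ : FormField E X p} (hφ : IsCalibration g φ) {f : X → ℝ}
    (hf : ContMDiff 𝓘(ℝ, E) 𝓘(ℝ, ℝ) ∞ f) {M : OrientedSubmanifold E X p}
    (hM : M.IsPhiSubmanifold g φ) (m : M.carrier)
    {e : Module.Basis (Fin p) ℝ (TangentSpace (𝓡 p) m)}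
    (he : IsOrthonormalFor (fun u v ↦ M.inducedMetric g m u v) e)
    (h1 : φ (M.incl m) (fun i ↦ mfderiv (𝓡 p) 𝓘(ℝ, E) M.incl m (e i)) = 1) :
    laplacian (M.inducedMetric g) (f ∘ M.incl) m =
      evalPVector (phiHessian g φ f (M.incl m))
        (exteriorPower.ιMulti ℝ p fun i ↦ mfderiv (𝓡 p) 𝓘(ℝ, E) M.incl m (e i)) := by
  let s₀ := extChartAt (𝓡 p) m m
  let Φ := M.coordIncl m
  let G := coordBilin g.inner (M.incl m)
  let θ := coordForm φ (M.incl m)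
  let F := f ∘ (extChartAt 𝓘(ℝ, E) (M.incl m)).symm
  have hΦ₀ : Φ s₀ = extChartAt 𝓘(ℝ, E) (M.incl m) (M.incl m) := M.coordIncl_extChartAt m
  have hΦ : ContDiffAt ℝ 2 Φ s₀ := M.contDiffAt_coordIncl m
  have htarget : (extChartAt 𝓘(ℝ, E) (M.incl m)).target ∈ 𝓝 (Φ s₀) := by
    rw [hΦ₀]
    exact extChartAt_target_mem_nhds _
  have hG : DifferentiableAt ℝ G (Φ s₀) := by
    rw [hΦ₀]
    exact differentiableAt_coordBilin g _
  have hθ : DifferentiableAt ℝ θ (Φ s₀) :=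
    ((hφ.smooth (M.incl m)).contDiffAt htarget).differentiableAt (by simp)
  have hpair : ∀ᶠ y in 𝓝 (Φ s₀), IsCalibratingPair (G y) (θ y) := by
    filter_upwards [htarget] with y hy using isCalibratingPair_coord hφ hy
  have hclosed : extDeriv θ (Φ s₀) = 0 := hφ.closed _ _ (mem_of_mem_nhds htarget)
  have hF : ContDiffAt ℝ 2 F (Φ s₀) := by
    have h := hf.comp_contMDiffOn (contMDiffOn_extChartAt_symm (I := 𝓘(ℝ, E)) (M.incl m))
    exact (h.contMDiffAt htarget).contDiffAt.of_le (by norm_cast)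
  have hcoord := M.eventually_coord_eq g φ m
  have hval : ∀ s (b : Fin p → EuclideanSpace ℝ (Fin p)),
      pullbackForm (Y := EuclideanSpace ℝ (Fin p)) (X := E) Φ θ s b =
        θ (Φ s) fun i ↦ fderiv ℝ Φ s (b i) := by
    intro s b
    unfold pullbackForm
    rw [mfderiv_eq_fderiv]
    rfl
  -- A point of the submanifold near `m` has a calibrated frame, which is read in the chart at `m`.
  have hframe : ∀ {m' : M.carrier} (hm' : m' ∈ (extChartAt (𝓡 p) m).source)
      (e' : Module.Basis (Fin p) ℝ (TangentSpace (𝓡 p) m')),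
      IsOrthonormalFor (fun u v ↦ M.inducedMetric g m' u v) e' →
      φ (M.incl m') (fun i ↦ mfderiv (𝓡 p) 𝓘(ℝ, E) M.incl m' (e' i)) = 1 →
      (pullbackMetric Φ G (extChartAt (𝓡 p) m m') =
          coordBilin (M.inducedMetric g) m (extChartAt (𝓡 p) m m') ∧
        pullbackForm (Y := EuclideanSpace ℝ (Fin p)) (X := E) Φ θ (extChartAt (𝓡 p) m m') =
          coordForm (pullbackForm M.incl φ) m (extChartAt (𝓡 p) m m')) →
      IsOrthonormalFor (fun u v ↦ pullbackMetric Φ G (extChartAt (𝓡 p) m m') u v)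
        (e'.map (chartEquiv hm').toLinearEquiv) ∧
      θ (Φ (extChartAt (𝓡 p) m m')) (fun i ↦ fderiv ℝ Φ (extChartAt (𝓡 p) m m')
        (e'.map (chartEquiv hm').toLinearEquiv i)) = 1 := by
    intro m' hm' e' he' h1' hc
    rw [← hval, hc.1, hc.2]
    exact M.orthonormal_chart g φ hm' he' h1'
  have hcal : ∀ᶠ s in 𝓝 s₀, ∃ b : Module.Basis (Fin p) ℝ (EuclideanSpace ℝ (Fin p)),
      IsOrthonormalFor (fun u v ↦ pullbackMetric Φ G s u v) b ∧
        θ (Φ s) (fun i ↦ fderiv ℝ Φ s (b i)) = 1 := by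
    filter_upwards [hcoord, M.eventually_incl_mem m] with s hs ⟨hst, _⟩
    obtain ⟨ξ, ⟨-, hξ1⟩, e', -, he', rfl⟩ := hM ((extChartAt (𝓡 p) m).symm s)
    rw [evalPVector_ιMulti] at hξ1
    have hr := (extChartAt (𝓡 p) m).right_inv hst
    have := hframe ((extChartAt (𝓡 p) m).map_target hst) e' he' hξ1 (by rw [hr]; exact hs)
    rw [hr] at this
    exact ⟨_, this⟩
  have hm : m ∈ (extChartAt (𝓡 p) m).source := mem_extChartAt_source m
  obtain ⟨hb, hb1⟩ := hframe hm e he h1 hcoord.self_of_nhds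
  have hmain := sum_coordHessian_comp hΦ hG hθ hpair hcal hclosed hF hb hb1
  have hv : IsOrthonormalFor (fun a b ↦ g.inner (M.incl m) a b)
      (fun i ↦ mfderiv (𝓡 p) 𝓘(ℝ, E) M.incl m (e i)) := he
  rw [evalPVector_phiHessian hφ f hv h1]
  refine (trace_inverse_comp (E := EuclideanSpace ℝ (Fin p)) (e := e) he).trans ?_
  have hcH : coordHessian (coordBilin (M.inducedMetric g) m)
      ((f ∘ M.incl) ∘ (extChartAt (𝓡 p) m).symm) s₀ =
      coordHessian (pullbackMetric Φ G) (F ∘ Φ) s₀ := by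
    refine coordHessian_congr (hcoord.mono fun s hs ↦ hs.1.symm) ?_
    filter_upwards [M.extChartAt_symm_coordIncl m] with s hs
    exact congrArg f hs.symm
  have hder : ∀ v : TangentSpace (𝓡 p) m, fderiv ℝ Φ s₀ (chartEquiv hm v) =
      mfderiv 𝓘(ℝ, E) 𝓘(ℝ, E) (extChartAt 𝓘(ℝ, E) (M.incl m)) (M.incl m)
        (mfderiv (𝓡 p) 𝓘(ℝ, E) M.incl m v) := by
    intro v
    have hev : Φ ∘ extChartAt (𝓡 p) m =ᶠ[𝓝 m] extChartAt 𝓘(ℝ, E) (M.incl m) ∘ M.incl := by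
      filter_upwards [extChartAt_symm_comp_extChartAt (E := EuclideanSpace ℝ (Fin p)) hm] with z hz
      exact congrArg (fun q ↦ extChartAt 𝓘(ℝ, E) (M.incl m) (M.incl q)) hz
    have h2 := congrArg (fun L ↦ L v) (hev.mfderiv_eq (I := 𝓡 p) (I' := 𝓘(ℝ, E)))
    have h3 := mfderiv_comp_apply (I := 𝓡 p) (I' := 𝓡 p) (I'' := 𝓘(ℝ, E)) m
      (hΦ.differentiableAt (by norm_num)).mdifferentiableAt (mdifferentiableAt_extChartAt' hm) v
    have h4 := mfderiv_comp_apply (I := 𝓡 p) (I' := 𝓘(ℝ, E)) (I'' := 𝓘(ℝ, E)) m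
      (mdifferentiableAt_extChartAt' (mem_extChartAt_source (I := 𝓘(ℝ, E)) (M.incl m)))
      ((M.contMDiff_incl m).mdifferentiableAt (by simp)) v
    rw [chartEquiv_apply, ← mfderiv_eq_fderiv]
    exact h3.symm.trans (h2.trans h4)
  have hl : ∀ k, hessian (M.inducedMetric g) (f ∘ M.incl) m (e k) (e k) =
      coordHessian (pullbackMetric Φ G) (F ∘ Φ) s₀ (chartEquiv hm (e k)) (chartEquiv hm (e k)) := by
    intro k
    rw [hessian_apply, ← chartEquiv_apply hm, ← hcH]
  have hr : ∀ k, hessian g.inner f (M.incl m) (mfderiv (𝓡 p) 𝓘(ℝ, E) M.incl m (e k))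
      (mfderiv (𝓡 p) 𝓘(ℝ, E) M.incl m (e k)) =
      coordHessian G F (Φ s₀) (fderiv ℝ Φ s₀ (chartEquiv hm (e k)))
        (fderiv ℝ Φ s₀ (chartEquiv hm (e k))) := by
    intro k
    rw [hessian_apply, hder, hΦ₀]
  exact (Finset.sum_congr rfl fun k _ ↦ hl k).trans
    (hmain.trans (Finset.sum_congr rfl fun k _ ↦ (hr k).symm))

end Submanifold

end Calibrated

theorem theorem1p4 {n p : ℕ} (hp : 0 < p)
    {X : Type*} [TopologicalSpace X] [ChartedSpace (EuclideanSpace ℝ (Fin n)) X]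
    [IsManifold (𝓡 n) ∞ X]
    (g : Calibrated.Metric (EuclideanSpace ℝ (Fin n)) X)
    (φ : Calibrated.FormField (EuclideanSpace ℝ (Fin n)) X p)
    (hφ : Calibrated.IsCalibration g φ)
    (f : X → ℝ) (hf : ContMDiff (𝓡 n) 𝓘(ℝ, ℝ) ∞ f) :
    (Calibrated.IsPlurisubharmonic g φ f →
      ∀ M : Calibrated.OrientedSubmanifold (EuclideanSpace ℝ (Fin n)) X p,
        M.IsPhiSubmanifold g φ →
          Calibrated.IsSubharmonic (M.inducedMetric g) (f ∘ M.incl)) ∧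
    (Calibrated.IsIntegrable g φ →
      (∀ M : Calibrated.OrientedSubmanifold (EuclideanSpace ℝ (Fin n)) X p,
        M.IsPhiSubmanifold g φ →
          Calibrated.IsSubharmonic (M.inducedMetric g) (f ∘ M.incl)) →
      Calibrated.IsPlurisubharmonic g φ f) := by
  refine ⟨fun hpsh M hM m ↦ ?_, fun hint hsub x ξ hξ ↦ ?_⟩
  · obtain ⟨ξ, hξ, e, -, he, rfl⟩ := hM m
    have h1 := hξ.2
    rw [Calibrated.evalPVector_ιMulti] at h1
    rw [Calibrated.laplacian_comp_incl_eq hφ hf hM m he h1]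
    exact hpsh _ _ hξ
  · obtain ⟨M, hM, m, η, ⟨e, -, he, rfl⟩, hη⟩ := hint x ξ hξ
    cases hη
    have h1 := hξ.2
    rw [Calibrated.evalPVector_ιMulti] at h1
    rw [← Calibrated.laplacian_comp_incl_eq hφ hf hM m he h1]
    exact hsub M hM m
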